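/- Let $G_1,\dots,G_q$ be connected commutative algebraic groups over $\mathbb C$, each embedded by $\theta_p$ as a locally closed subvariety of a projective space $\mathbb P^{n_p}_{\mathbb C}$, and let $G=G_1\times\dots\times G_q\subseteq \mathbb P^{n_1}_{\mathbb C}\times\dots\times\mathbb P^{n_q}_{\mathbb C}$. Let $\mathbb C[\mathbf x]$ be the polynomial ring in the variables $x_{p,i}$ ($1\le p\le q$, $0\le i\le n_p$), graded by $\mathbb N^q$ so that $x_{p,i}$ has multidegree $\mathbf e_p$. Let $\Delta=\{\partial_1,\dots,\partial_w\}$ be linearly independent translation-invariant derivations on $G$, let $\Sigma\subseteq G(\mathbb C)$ be a nonempty finite set of points at which no $x_{p,0}$ ($1\le p\le q$) vanishes, and let $T\ge 1$. For $\mathbf d\in\mathbb N^q$ let $$\mathrm{ev}_{\Sigma,T,\mathbf d}:\mathbb C[\mathbf x]_{\mathbf d}\to\mathbb C^{|\Sigma|\binom{T-1+w}{w}},\qquad P\mapsto\Big(\partial_1^{\sigma_1}\cdots\partial_w^{\sigma_w}\Big(\frac{P}{x_{1,0}^{d_1}\cdots x_{q,0}^{d_q}}\Big)(\gamma)\Big)_{\gamma\in\Sigma,\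 \sigma\in\mathbb N^w,\ \sigma_1+\dots+\sigma_w<T},$$ and let the interpolation ideal $I^{\Sigma,T}\subseteq\mathbb C[\mathbf x]$ be the ideal generated by all the kernels $\ker(\mathrm{ev}_{\Sigma,T,\mathbf d})$, $\mathbf d\in\mathbb N^q$. Then: 1. $I^{\Sigma,T}$ is a multihomogeneous ideal and $I^{\Sigma,T}\cap\mathbb C[\mathbf x]_{\mathbf d}=\ker(\mathrm{ev}_{\Sigma,T,\mathbf d})$ for every $\mathbf d$, i.e. $I^{\Sigma,T}=\bigoplus_{\mathbf d}\ker(\mathrm{ev}_{\Sigma,T,\mathbf d})$. 2. $\mathrm{ev}_{\Sigma,T,\mathbf d}$ is surjective whenever all $d_p\ge T|\Sigma|$. 3. The multiprojective subscheme defined by $I^{\Sigma,T}$ (whose points are the multihomogeneous primes $\mathfrak p\supseteq I^{\Sigma,T}$ that do not contain $\mathbb C[\mathbf x]_{\mathbf d}$ for all large $\mathbf d$) is zero-dimensional, and its degree is $|\Sigma|\binom{T-1+w}{w}$, where $w=|\Delta|$; that is, the Hilbert polynomial of $\mathbb C[\mathbf x]/I^{\Sigma,T}$ is this constant. 4. For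 every $\gamma\in\Sigma$, the ideal $I^{\{\gamma\},1}$ is the prime ideal of the point $\gamma$, generated by the multihomogeneous polynomials vanishing at $\gamma$, and $I^{\{\gamma\},T}$ is primary with radical $I^{\{\gamma\},1}$. 5. The minimal primary decomposition of $I^{\Sigma,T}$ is $I^{\Sigma,T}=\bigcap_{\gamma\in\Sigma}I^{\{\gamma\},T}$: the ideals $I^{\{\gamma\},T}$ are pairwise distinct, they form a minimal primary decomposition, and it is the only one. -/

import Mathlib

open MvPolynomial
open scoped LinearAlgebra.Projectivization

noncomputable section

namespace MultiProj

/-! ### The multigraded polynomial ring -/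

/-- The variables `x_{p,i}`, where `p` runs over `ι` and `i = 0, …, n p`. -/
abbrev Var {ι : Type} (n : ι → ℕ) : Type := Σ p : ι, Fin (n p + 1)

/-- The polynomial ring `ℂ[x]` in the variables `x_{p,i}`. -/
abbrev Poly {ι : Type} (n : ι → ℕ) : Type := MvPolynomial (Var n) ℂ

/-- The variable `x_{p,i}` has multidegree `e_p`. -/
def multideg {ι : Type} [DecidableEq ι] (n : ι → ℕ) (v : Var n) : ι → ℕ := Pi.single v.1 1

/-- The space `ℂ[x]_d` of multihomogeneous polynomials of multidegree `d`. -/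
abbrev Component {ι : Type} [DecidableEq ι] (n : ι → ℕ) (d : ι → ℕ) : Submodule ℂ (Poly n) :=
  weightedHomogeneousSubmodule ℂ (multideg n) d

instance {ι : Type} [Fintype ι] [DecidableEq ι] (n : ι → ℕ) : GradedAlgebra (Component n) :=
  weightedGradedAlgebra ℂ (multideg n)

/-- An ideal `I` is irrelevant if `I_d = ℂ[x]_d` for all large enough `d`. -/
def IsIrrelevant {ι : Type} [DecidableEq ι] {n : ι → ℕ} (I : Ideal (Poly n)) : Prop :=
  ∃ d₀ : ι → ℕ, ∀ d, d₀ ≤ d → ∀ F ∈ Component n d, F ∈ I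

/-- The points of the multiprojective space as a scheme over `ℂ`: the relevant multihomogeneous
prime ideals of `ℂ[x]`. -/
structure SchemePoint {ι : Type} [Fintype ι] [DecidableEq ι] (n : ι → ℕ) where
  ideal : Ideal (Poly n)
  isPrime : ideal.IsPrime
  isHomogeneous : ideal.IsHomogeneous (Component n)
  relevant : ¬ IsIrrelevant ideal

/-- The Zariski topology on the multiprojective space. -/
instance {ι : Type} [Fintype ι] [DecidableEq ι] (n : ι → ℕ) : TopologicalSpace (SchemePoint n) :=
  TopologicalSpace.induced (fun p => (⟨p.ideal, p.isPrime⟩ : PrimeSpectrum (Poly n))) inferInstance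

/-- The closed set of points underlying the multiprojective subscheme defined by `I`. -/
def zeroScheme {ι : Type} [Fintype ι] [DecidableEq ι] {n : ι → ℕ} (I : Ideal (Poly n)) :
    Set (SchemePoint n) :=
  {p | I ≤ p.ideal}

/-- The Hilbert function `d ↦ dim_ℂ (ℂ[x] / I)_d = dim_ℂ (ℂ[x]_d / (I ∩ ℂ[x]_d))`. -/
def hilbertFunction {ι : Type} [DecidableEq ι] {n : ι → ℕ} (I : Ideal (Poly n)) (d : ι → ℕ) : ℕ :=
  Module.finrank ℂ (Component n d ⧸ (I.restrictScalars ℂ).comap (Component n d).subtype)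

/-- `P` is a Hilbert polynomial of `ℂ[x] / I`: it agrees with the Hilbert function for all large
enough multidegrees. -/
def IsHilbertPolynomial {ι : Type} [DecidableEq ι] {n : ι → ℕ} (I : Ideal (Poly n))
    (P : MvPolynomial ι ℚ) : Prop :=
  ∃ d₀ : ι → ℕ, ∀ d, d₀ ≤ d → (hilbertFunction I d : ℚ) = eval (fun p => (d p : ℚ)) P

/-- The ideal `I` has degree `N`: the (unique) Hilbert polynomial of `ℂ[x] / I` is the
constant `N`. -/
def HasDegree {ι : Type} [DecidableEq ι] {n : ι → ℕ} (I : Ideal (Poly n)) (N : ℕ) : Prop :=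
  ∀ P : MvPolynomial ι ℚ, IsHilbertPolynomial I P ↔ P = C (N : ℚ)

/-! ### Complex points and embedded quasi-projective varieties -/

/-- The complex points of the multiprojective space `∏ p, ℙ^{n p}`. -/
abbrev Points {ι : Type} (n : ι → ℕ) : Type := ∀ p : ι, ℙ ℂ (Fin (n p + 1) → ℂ)

/-- Value of a polynomial at a chosen representative of a point. For `F` multihomogeneous, only
its vanishing, and the quotient of two values in the same multidegree, are ever used; they do not
depend on the representative. -/
def value {ι : Type} {n : ι → ℕ} (F : Poly n) (x : Points n) : ℂ :=
  eval (fun v : Var n => (x v.1).rep v.2) F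

/-- The Zariski topology on a set `X` of complex points, given through an embedding
`e : X → ∏ p, ℙ^{n p}`: the topology generated by the sets `F ≠ 0` with `F` multihomogeneous. -/
@[reducible]
def zariski {ι : Type} [DecidableEq ι] {n : ι → ℕ} {X : Type*} (e : X → Points n) :
    TopologicalSpace X :=
  TopologicalSpace.generateFrom {U | ∃ d, ∃ F ∈ Component n d, U = {x | value F (e x) ≠ 0}}

/-- Zariski open subsets of `X`. -/
abbrev ZOpen {ι : Type} [DecidableEq ι] {n : ι → ℕ} {X : Type*} (e : X → Points n) : Type _ :=
  {U : Set X // @IsOpen X (zariski e) U}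

/-- A function on `U ⊆ X` is regular if near every point of `U` it is a quotient `P / Q` of
multihomogeneous polynomials of the same multidegree. -/
def IsRegular {ι : Type} [DecidableEq ι] {n : ι → ℕ} {X : Type*} (e : X → Points n) (U : Set X)
    (f : U → ℂ) : Prop :=
  ∀ x : U, ∃ d, ∃ P ∈ Component n d, ∃ Q ∈ Component n d, value Q (e x) ≠ 0 ∧
    ∀ y : U, value Q (e y) ≠ 0 → f y = value P (e y) / value Q (e y)

/-- The `ℂ`-algebra of regular functions on `U`. -/
def regular {ι : Type} [DecidableEq ι] {n : ι → ℕ} {X : Type*} (e : X → Points n) (U : Set X) :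
    Subalgebra ℂ (U → ℂ) where
  carrier := {f | IsRegular e U f}
  mul_mem' := by
    intro f g hf hg x
    obtain ⟨d, P, hP, Q, hQ, h0, h⟩ := hf x
    obtain ⟨d', P', hP', Q', hQ', h0', h'⟩ := hg x
    refine ⟨d + d', P * P', IsWeightedHomogeneous.mul hP hP', Q * Q',
      IsWeightedHomogeneous.mul hQ hQ', by simpa [value] using And.intro h0 h0', fun y hy => ?_⟩
    have hy' : value Q (e y) ≠ 0 ∧ value Q' (e y) ≠ 0 := by simpa [value] using hy
    rw [Pi.mul_apply, h y hy'.1, h' y hy'.2]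
    simp only [value, map_mul]
    rw [div_mul_div_comm]
  add_mem' := by
    intro f g hf hg x
    obtain ⟨d, P, hP, Q, hQ, h0, h⟩ := hf x
    obtain ⟨d', P', hP', Q', hQ', h0', h'⟩ := hg x
    refine ⟨d + d', P * Q' + Q * P', Submodule.add_mem _ (IsWeightedHomogeneous.mul hP hQ')
      (IsWeightedHomogeneous.mul hQ hP'), Q * Q',
      IsWeightedHomogeneous.mul hQ hQ', by simpa [value] using And.intro h0 h0', fun y hy => ?_⟩
    have hy' : value Q (e y) ≠ 0 ∧ value Q' (e y) ≠ 0 := by simpa [value] using hy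
    rw [Pi.add_apply, h y hy'.1, h' y hy'.2, div_add_div _ _ hy'.1 hy'.2]
    simp only [value, map_mul, map_add]
  algebraMap_mem' := by
    intro c x
    refine ⟨0, C c, isWeightedHomogeneous_C _ c, 1, isWeightedHomogeneous_one _ _,
      by simp [value], fun y _ => ?_⟩
    simp [value]

/-- A map `φ : X → Y` of embedded quasi-projective varieties is a morphism if near every point
each of its components is given by multihomogeneous polynomials `F_0, …, F_m` of the same
multidegree, not all zero at that point. (The formula is required wherever the `F_i` do not all
vanish; a formula valid on a smaller neighbourhood takes this form after multiplying all `F_i` by a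
multihomogeneous polynomial that vanishes outside of the neighbourhood but not at the point.) -/
def IsMorphism {ι κ : Type} [DecidableEq ι] {n : ι → ℕ} {m : κ → ℕ}
    {X Y : Type*} (e : X → Points n) (f : Y → Points m) (φ : X → Y) : Prop :=
  ∀ x : X, ∀ s : κ, ∃ d, ∃ F : Fin (m s + 1) → Poly n, (∀ i, F i ∈ Component n d) ∧
    (fun i => value (F i) (e x)) ≠ 0 ∧
    ∀ y : X, ∀ h : (fun i => value (F i) (e y)) ≠ 0,
      Projectivization.mk ℂ (fun i => value (F i) (e y)) h = f (φ y) s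

/-- The embedding of `X × X` induced by an embedding of `X`. -/
def prodEmb {ι : Type} {n : ι → ℕ} {X : Type*} (e : X → Points n) :
    X × X → Points (fun s : Bool × ι => n s.2) :=
  fun x s => e (bif s.1 then x.2 else x.1) s.2

/-- A map to a projective space as a map to a multiprojective space with one factor. -/
def single {m : ℕ} {X : Type*} (θ : X → ℙ ℂ (Fin (m + 1) → ℂ)) : X → Points (fun _ : Unit => m) :=
  fun x _ => θ x

/-- `θ` realizes the commutative group `G` as the group of complex points of a connected
commutative algebraic group, embedded as a locally closed subvariety of `ℙ^m` (hence open in its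
Zariski closure, which is a projective compactification of it). -/
structure IsConnectedAlgebraicGroup {m : ℕ} {G : Type*} [CommGroup G]
    (θ : G → ℙ ℂ (Fin (m + 1) → ℂ)) : Prop where
  injective : Function.Injective θ
  isLocallyClosed :
    @IsLocallyClosed _ (zariski (id : Points (fun _ : Unit => m) → _)) (Set.range (single θ))
  connected : @ConnectedSpace G (zariski (single θ))
  mul : IsMorphism (prodEmb (single θ)) (single θ) (fun x : G × G => x.1 * x.2)
  inv : IsMorphism (single θ) (single θ) (fun x : G => x⁻¹)

/-- The embedding of the product group `∏ p, G p` into `∏ p, ℙ^{n p}`. -/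
def piEmb {ι : Type} {n : ι → ℕ} {G : ι → Type*} (θ : ∀ p, G p → ℙ ℂ (Fin (n p + 1) → ℂ)) :
    (∀ p, G p) → Points n :=
  fun g p => θ p (g p)

/-! ### Invariant derivations -/

/-- The Lie algebra of `X`, as a complex vector space: the `ℂ`-linear derivations of the sheaf of
regular functions (families of derivations of the algebras of regular functions on all Zariski
open sets, compatible with restrictions) which commute with all translations. -/
def invariantDerivations {ι : Type} [DecidableEq ι] {n : ι → ℕ} {X : Type*} [CommGroup X]
    (e : X → Points n) :
    Submodule ℂ (∀ U : ZOpen e, Derivation ℂ (regular e U.1) (regular e U.1)) where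
  carrier := {D |
    (∀ (U V : ZOpen e) (hVU : ∀ x ∈ V.1, x ∈ U.1) (f : regular e U.1) (f' : regular e V.1),
      (∀ x : V.1, f'.1 x = f.1 ⟨x.1, hVU x.1 x.2⟩) →
      ∀ x : V.1, (D V f').1 x = (D U f).1 ⟨x.1, hVU x.1 x.2⟩) ∧
    (∀ (g : X) (U V : ZOpen e) (hVU : ∀ x ∈ V.1, g * x ∈ U.1) (f : regular e U.1)
      (f' : regular e V.1), (∀ x : V.1, f'.1 x = f.1 ⟨g * x.1, hVU x.1 x.2⟩) →
      ∀ x : V.1, (D V f').1 x = (D U f).1 ⟨g * x.1, hVU x.1 x.2⟩)}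
  add_mem' := by
    rintro D D' ⟨h1, h2⟩ ⟨h1', h2'⟩
    constructor
    · intro U V hVU f f' h x
      simp [h1 U V hVU f f' h x, h1' U V hVU f f' h x]
    · intro g U V hVU f f' h x
      simp [h2 g U V hVU f f' h x, h2' g U V hVU f f' h x]
  zero_mem' := by
    constructor
    · intro U V hVU f f' h x
      simp
    · intro g U V hVU f f' h x
      simp
  smul_mem' := by
    rintro c D ⟨h1, h2⟩
    constructor
    · intro U V hVU f f' h x
      simp [h1 U V hVU f f' h x]
    · intro g U V hVU f f' h x
      simp [h2 g U V hVU f f' h x]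

/-- The operator `∂^σ = ∂_1^{σ_1} ⋯ ∂_w^{σ_w}` on the regular functions on `U`. -/
def diffOp {ι : Type} [DecidableEq ι] {n : ι → ℕ} {X : Type*} [CommGroup X] {e : X → Points n}
    {w : ℕ} (D : Fin w → invariantDerivations e) (σ : Fin w → ℕ) (U : ZOpen e) :
    Module.End ℂ (regular e U.1) :=
  (List.ofFn fun j => ((D j).1 U : regular e U.1 →ₗ[ℂ] regular e U.1) ^ σ j).prod

/-! ### Evaluation and the interpolation ideal -/

/-- The monomial `∏ p, x_{p,0} ^ d p`. -/
def denom {ι : Type} [Fintype ι] (n : ι → ℕ) (d : ι → ℕ) : Poly n :=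
  ∏ p, X (⟨p, 0⟩ : Var n) ^ d p

theorem denom_mem {ι : Type} [Fintype ι] [DecidableEq ι] (n : ι → ℕ) (d : ι → ℕ) :
    denom n d ∈ Component n d := by
  have h : d = ∑ p, d p • multideg n (⟨p, 0⟩ : Var n) := by
    funext q
    simp [multideg, Finset.sum_apply, Pi.single_apply]
  have h2 : (denom n d).IsWeightedHomogeneous (multideg n)
      (∑ p, d p • multideg n (⟨p, 0⟩ : Var n)) :=
    IsWeightedHomogeneous.prod _ _ _ fun p _ =>
      (isWeightedHomogeneous_X ℂ (multideg n) (⟨p, 0⟩ : Var n)).pow (d p)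
  rw [← h] at h2
  exact h2

theorem value_denom {ι : Type} [Fintype ι] {n : ι → ℕ} (d : ι → ℕ) (x : Points n) :
    value (denom n d) x = ∏ p, (x p).rep 0 ^ d p := by
  simp [value, denom]

/-- The affine chart of `X`: the points with `x_{p,0} ≠ 0` for all `p`. -/
def chart {ι : Type} [Fintype ι] [DecidableEq ι] {n : ι → ℕ} {X : Type*} (e : X → Points n) :
    ZOpen e :=
  ⟨{x | ∀ p, (e x p).rep 0 ≠ 0}, TopologicalSpace.isOpen_generateFrom_of_mem
    ⟨1, denom n 1, denom_mem n 1, by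
      ext x
      simp [value_denom, Finset.prod_ne_zero_iff]⟩⟩

/-- The regular function `P / ∏ p, x_{p,0} ^ d p` on the affine chart. -/
def dehomogenize {ι : Type} [Fintype ι] [DecidableEq ι] {n : ι → ℕ} {X : Type*} (e : X → Points n)
    (d : ι → ℕ) : Component n d →ₗ[ℂ] regular e (chart e).1 where
  toFun P := ⟨fun x => value P.1 (e x) / value (denom n d) (e x), fun x =>
    ⟨d, P.1, P.2, denom n d, denom_mem n d, by
      rw [value_denom, Finset.prod_ne_zero_iff]
      exact fun p _ => pow_ne_zero _ (x.2 p), fun _ _ => rfl⟩⟩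
  map_add' P Q := by
    ext x
    simp [value, add_div]
  map_smul' c P := by
    ext x
    simp [value, mul_div_assoc]

/-- The evaluation operator: it sends `P ∈ ℂ[x]_d` to the family of all values
`∂^σ (P / ∏ p, x_{p,0} ^ d p) (γ)` with `γ ∈ S` and `|σ| < T`. -/
def ev {ι : Type} [Fintype ι] [DecidableEq ι] {n : ι → ℕ} {X : Type*} [CommGroup X]
    {e : X → Points n} {w : ℕ} (D : Fin w → invariantDerivations e) (S : Finset (chart e).1)
    (T : ℕ) (d : ι → ℕ) :
    Component n d →ₗ[ℂ] (S × {σ : Fin w → ℕ // ∑ j, σ j < T} → ℂ) where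
  toFun P s := (diffOp D s.2.1 (chart e) (dehomogenize e d P)).1 s.1.1
  map_add' P Q := by
    ext s
    simp
  map_smul' c P := by
    ext s
    simp

/-- The interpolation ideal: the ideal generated by the multihomogeneous polynomials in the
kernels of the evaluation operators, that is, by those vanishing at the points of `S` to order
`T` in the directions `D`. -/
def interpolationIdeal {ι : Type} [Fintype ι] [DecidableEq ι] {n : ι → ℕ} {X : Type*} [CommGroup X]
    {e : X → Points n} {w : ℕ} (D : Fin w → invariantDerivations e) (S : Finset (chart e).1)
    (T : ℕ) : Ideal (Poly n) :=
  Ideal.span {F | ∃ (d : ι → ℕ) (P : Component n d), ev D S T d P = 0 ∧ F = P.1}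

/-- The ideal of a complex point: generated by the multihomogeneous polynomials vanishing there. -/
def pointIdeal {ι : Type} [DecidableEq ι] {n : ι → ℕ} (x : Points n) : Ideal (Poly n) :=
  Ideal.span {F | ∃ d, F ∈ Component n d ∧ value F x = 0}

end MultiProj

end

open scoped TensorProduct

noncomputable section

namespace MultiProj

/-! ### Multihomogeneous polynomials and their values -/

/-- Rescaling the variables of each block multiplies a multihomogeneous polynomial by a monomial
in the scaling factors. -/
theorem aeval_rescale {ι : Type} [Fintype ι] [DecidableEq ι] {n : ι → ℕ} {A : Type*} [CommRing A]
    [Algebra ℂ A] (t : ι → A) (a : Var n → A) {d : ι → ℕ} {P : Poly n} (hP : P ∈ Component n d) :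
    aeval (fun v => t v.1 * a v) P = (∏ p, t p ^ d p) * aeval a P := by
  refine IsWeightedHomogeneous.induction_on
    (motive := fun P _ => aeval (fun v => t v.1 * a v) P = (∏ p, t p ^ d p) * aeval a P)
    (by simp) (fun P Q _ _ h1 h2 => by simp only [map_add, h1, h2, mul_add]) ?_ hP
  rintro m r rfl
  simp only [aeval_monomial, mul_pow, Finsupp.prod_mul]
  -- Collecting the factors by block: the exponent of `t p` is the total degree of the monomial in
  -- block `p`.
  have h : (m.prod fun v k => t v.1 ^ k) =
      ∏ p, t p ^ (Finsupp.weight (multideg n) m) p := by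
    rw [Finsupp.weight_apply, Finsupp.sum, Finsupp.prod]
    simp only [Finset.sum_apply, Pi.smul_apply, multideg, ← Finset.prod_pow_eq_pow_sum]
    rw [Finset.prod_comm]
    refine Finset.prod_congr rfl fun v _ => ?_
    rw [Finset.prod_eq_single v.1]
    · simp
    · intro p _ hp
      simp [hp]
    · simp
  rw [h]
  ring

theorem value_mul {ι : Type} {n : ι → ℕ} (F F' : Poly n) (x : Points n) :
    value (F * F') x = value F x * value F' x :=
  map_mul _ _ _

theorem value_eq_of_rep_eq {ι : Type} [Fintype ι] [DecidableEq ι] {n : ι → ℕ} {d : ι → ℕ}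
    {P : Poly n} (hP : P ∈ Component n d) {x : Points n} {t : ι → ℂ} {a : Var n → ℂ}
    (h : ∀ v : Var n, (x v.1).rep v.2 = t v.1 * a v) :
    value P x = (∏ p, t p ^ d p) * eval a P := by
  have := aeval_rescale t a hP
  rw [value]
  simp only [h]
  simpa [aeval_eq_eval] using this

/-! ### Zariski open sets and regular functions -/

/-- Products of multihomogeneous polynomials are multihomogeneous, so the generating sets are stable
under intersection and form a basis. -/
theorem exists_basic_of_isOpen {ι : Type} [DecidableEq ι] {n : ι → ℕ} {X : Type*}
    {e : X → Points n} {U : Set X} (hU : @IsOpen X (zariski e) U) {x : X} (hx : x ∈ U) :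
    ∃ d, ∃ F ∈ Component n d, value F (e x) ≠ 0 ∧ ∀ y, value F (e y) ≠ 0 → y ∈ U := by
  induction hU with
  | basic s hs =>
    obtain ⟨d, F, hF, rfl⟩ := hs
    exact ⟨d, F, hF, hx, fun y hy => hy⟩
  | univ => exact ⟨0, 1, isWeightedHomogeneous_one _ _, by simp [value], fun y _ => trivial⟩
  | inter s t _ _ h1 h2 =>
    obtain ⟨d, F, hF, h0, h⟩ := h1 hx.1
    obtain ⟨d', F', hF', h0', h'⟩ := h2 hx.2
    refine ⟨d + d', F * F', IsWeightedHomogeneous.mul hF hF', ?_, fun y hy => ?_⟩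
    · rw [value_mul]
      exact mul_ne_zero h0 h0'
    · rw [value_mul] at hy
      exact ⟨h y (left_ne_zero_of_mul hy), h' y (right_ne_zero_of_mul hy)⟩
  | sUnion s _ h =>
    obtain ⟨t, ht, hxt⟩ := hx
    obtain ⟨d, F, hF, h0, h1⟩ := h t ht hxt
    exact ⟨d, F, hF, h0, fun y hy => ⟨t, ht, h1 y hy⟩⟩

theorem isOpen_of_basic {ι : Type} [DecidableEq ι] {n : ι → ℕ} {X : Type*}
    {e : X → Points n} {U : Set X}
    (h : ∀ x ∈ U, ∃ d, ∃ F ∈ Component n d, value F (e x) ≠ 0 ∧ ∀ y, value F (e y) ≠ 0 → y ∈ U) :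
    @IsOpen X (zariski e) U := by
  let _ := zariski e
  rw [isOpen_iff_forall_mem_open]
  intro x hx
  obtain ⟨d, F, hF, h0, h1⟩ := h x hx
  exact ⟨{y | value F (e y) ≠ 0}, h1,
    TopologicalSpace.isOpen_generateFrom_of_mem ⟨d, F, hF, rfl⟩, h0⟩

/-- The nonvanishing locus of a regular function is open. -/
theorem isOpen_ne_zero {ι : Type} [DecidableEq ι] {n : ι → ℕ} {X : Type*}
    {e : X → Points n} (U : ZOpen e) (f : regular e U.1) :
    @IsOpen X (zariski e) {x | ∃ h : x ∈ U.1, f.1 ⟨x, h⟩ ≠ 0} := by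
  refine isOpen_of_basic ?_
  rintro x ⟨hx, hfx⟩
  obtain ⟨d, P, hP, Q, hQ, h0, h⟩ := f.2 ⟨x, hx⟩
  obtain ⟨d', F, hF, hF0, hFU⟩ := exists_basic_of_isOpen U.2 hx
  -- `F` keeps the point inside `U`, `Q` makes the local formula `P / Q` valid, and `P` makes its
  -- value nonzero.
  refine ⟨d + d + d', P * Q * F, (IsWeightedHomogeneous.mul hP hQ).mul hF, ?_, fun y hy => ?_⟩
  · rw [h _ h0] at hfx
    simp only [value_mul]
    exact mul_ne_zero (mul_ne_zero (fun h => hfx (by simp [h])) h0) hF0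
  · simp only [value_mul] at hy
    have hyU := hFU y (right_ne_zero_of_mul hy)
    have hy' := left_ne_zero_of_mul hy
    refine ⟨hyU, ?_⟩
    rw [h ⟨y, hyU⟩ (right_ne_zero_of_mul hy')]
    exact div_ne_zero (left_ne_zero_of_mul hy') (right_ne_zero_of_mul hy')

/-- The quotient of two regular functions on a subset where the denominator does not vanish. -/
def regularDiv {ι : Type} [DecidableEq ι] {n : ι → ℕ} {X : Type*} {e : X → Points n}
    {U V : Set X} (hVU : ∀ x ∈ V, x ∈ U) (f g : regular e U)
    (hg : ∀ x : V, g.1 ⟨x.1, hVU x.1 x.2⟩ ≠ 0) : regular e V :=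
  ⟨fun x => f.1 ⟨x.1, hVU x.1 x.2⟩ / g.1 ⟨x.1, hVU x.1 x.2⟩, fun x => by
    obtain ⟨d, P, hP, Q, hQ, h0, h⟩ := f.2 ⟨x.1, hVU x.1 x.2⟩
    obtain ⟨d', P', hP', Q', hQ', h0', h'⟩ := g.2 ⟨x.1, hVU x.1 x.2⟩
    have hgx := hg x
    rw [h' _ h0'] at hgx
    -- The extra factor `Q'` in `P Q' / (Q P')` ensures that the formula for `g` is available
    -- wherever the new denominator is nonzero.
    refine ⟨d + d' + d', P * Q' * Q', (IsWeightedHomogeneous.mul hP hQ').mul hQ', Q * P' * Q',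
      (IsWeightedHomogeneous.mul hQ hP').mul hQ', ?_, fun y hy => ?_⟩
    · simp only [value_mul]
      exact mul_ne_zero (mul_ne_zero h0 (fun h => hgx (by simp [h]))) h0'
    · simp only [value_mul] at hy ⊢
      have h1 := right_ne_zero_of_mul hy
      have h2 := left_ne_zero_of_mul hy
      rw [h ⟨y.1, hVU y.1 y.2⟩ (left_ne_zero_of_mul h2), h' ⟨y.1, hVU y.1 y.2⟩ h1]
      have h3 := left_ne_zero_of_mul h2
      have h4 := right_ne_zero_of_mul h2
      simp only at h1 h3 h4 ⊢
      field_simp⟩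

/-- Restriction of regular functions. -/
def res {ι : Type} [DecidableEq ι] {n : ι → ℕ} {X : Type*} {e : X → Points n}
    {U V : Set X} (hVU : ∀ x ∈ V, x ∈ U) (f : regular e U) : regular e V :=
  ⟨fun x => f.1 ⟨x.1, hVU x.1 x.2⟩, fun x => by
    obtain ⟨d, P, hP, Q, hQ, h0, h⟩ := f.2 ⟨x.1, hVU x.1 x.2⟩
    exact ⟨d, P, hP, Q, hQ, h0, fun y hy => h ⟨y.1, hVU y.1 y.2⟩ hy⟩⟩

/-- Evaluation of regular functions at a point. -/
def evalAt {ι : Type} [DecidableEq ι] {n : ι → ℕ} {X : Type*} (e : X → Points n)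
    {U : Set X} (x : U) : regular e U →ₐ[ℂ] ℂ :=
  (Pi.evalAlgHom ℂ (fun _ : U => ℂ) x).comp (regular e U).val

@[simp]
theorem evalAt_apply {ι : Type} [DecidableEq ι] {n : ι → ℕ} {X : Type*} (e : X → Points n)
    {U : Set X} (x : U) (f : regular e U) : evalAt e x f = f.1 x :=
  rfl

/-- The standard affine charts: the points with `x_{p,j p} ≠ 0` for all `p`. -/
def chartAt {ι : Type} [Fintype ι] [DecidableEq ι] {n : ι → ℕ} {X : Type*} (e : X → Points n)
    (j : ∀ p, Fin (n p + 1)) : ZOpen e :=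
  ⟨{x | ∀ p, (e x p).rep (j p) ≠ 0}, TopologicalSpace.isOpen_generateFrom_of_mem
    ⟨∑ p, multideg n (⟨p, j p⟩ : Var n), ∏ p, MvPolynomial.X (⟨p, j p⟩ : Var n),
      IsWeightedHomogeneous.prod _ _ _ fun p _ => isWeightedHomogeneous_X ℂ _ _, by
      ext x
      simp [value, Finset.prod_ne_zero_iff]⟩⟩

theorem exists_mem_chartAt {ι : Type} [Fintype ι] [DecidableEq ι] {n : ι → ℕ} {X : Type*}
    (e : X → Points n) (x : X) : ∃ j, x ∈ (chartAt e j).1 := by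
  choose j hj using fun p => Function.ne_iff.mp (Projectivization.rep_nonzero (e x p))
  exact ⟨j, hj⟩

/-- The affine coordinates `x_{p,i} / x_{p,j p}` on a standard chart. -/
def coord {ι : Type} [Fintype ι] [DecidableEq ι] {n : ι → ℕ} {X : Type*} (e : X → Points n)
    (j : ∀ p, Fin (n p + 1)) (v : Var n) : regular e (chartAt e j).1 :=
  ⟨fun x => (e x v.1).rep v.2 / (e x v.1).rep (j v.1), fun x =>
    ⟨multideg n v, MvPolynomial.X v, isWeightedHomogeneous_X ℂ _ _,
      MvPolynomial.X (⟨v.1, j v.1⟩ : Var n), isWeightedHomogeneous_X ℂ (multideg n) ⟨v.1, j v.1⟩,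
      by simpa [value] using x.2 v.1, fun y _ => by simp [value]⟩⟩

theorem rep_eq_mul_coord {ι : Type} [Fintype ι] [DecidableEq ι] {n : ι → ℕ} {X : Type*}
    (e : X → Points n) (j : ∀ p, Fin (n p + 1)) (x : (chartAt e j).1) (v : Var n) :
    (e x v.1).rep v.2 = (e x v.1).rep (j v.1) * (coord e j v).1 x :=
  (mul_div_cancel₀ _ (x.2 v.1)).symm

theorem value_eq_mul_eval_coord {ι : Type} [Fintype ι] [DecidableEq ι] {n : ι → ℕ} {X : Type*}
    (e : X → Points n) (j : ∀ p, Fin (n p + 1)) (x : (chartAt e j).1) {d : ι → ℕ} {P : Poly n}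
    (hP : P ∈ Component n d) :
    value P (e x) = (∏ p, (e x p).rep (j p) ^ d p) * eval (fun v => (coord e j v).1 x) P :=
  value_eq_of_rep_eq hP (rep_eq_mul_coord e j x)

theorem aeval_regular_apply {ι κ : Type} [DecidableEq ι] {n : ι → ℕ} {X : Type*}
    {e : X → Points n} {U : Set X} (a : κ → regular e U) (P : MvPolynomial κ ℂ) (x : U) :
    (aeval a P : regular e U).1 x = eval (fun v => (a v).1 x) P := by
  have := (comp_aeval_apply a (evalAt e x) P)
  simpa [aeval_eq_eval] using this

/-! ### Separation of variables in functions of a product -/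

section Separation

variable {ι : Type} [DecidableEq ι] {n : ι → ℕ} {X : Type*} {e : X → Points n} {U V : Set X}

/-- Value at a pair of points of an element of the tensor product of two algebras of regular
functions. -/
def evalPair (h : U) (k : V) : regular e U ⊗[ℂ] regular e V →ₐ[ℂ] ℂ :=
  Algebra.TensorProduct.productMap (evalAt e h) (evalAt e k)

@[simp]
theorem evalPair_tmul (h : U) (k : V) (a : regular e U) (b : regular e V) :
    evalPair h k (a ⊗ₜ b) = a.1 h * b.1 k :=
  Algebra.TensorProduct.productMap_apply_tmul _ _ _ _

/-- Evaluation of the first variable. -/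
def evalLeft (h : U) : regular e U ⊗[ℂ] regular e V →ₗ[ℂ] regular e V :=
  (TensorProduct.lid ℂ _).toLinearMap ∘ₗ (evalAt e h).toLinearMap.rTensor (regular e V)

/-- Evaluation of the second variable. -/
def evalRight (k : V) : regular e U ⊗[ℂ] regular e V →ₗ[ℂ] regular e U :=
  (TensorProduct.rid ℂ _).toLinearMap ∘ₗ (evalAt e k).toLinearMap.lTensor (regular e U)

theorem evalLeft_apply (h : U) (k : V) (t : regular e U ⊗[ℂ] regular e V) :
    (evalLeft h t).1 k = evalPair h k t := by
  induction t with
  | zero => simp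
  | tmul a b => simp [evalLeft]
  | add s t hs ht => simp [← hs, ← ht]

theorem evalRight_apply (h : U) (k : V) (t : regular e U ⊗[ℂ] regular e V) :
    (evalRight k t).1 h = evalPair h k t := by
  induction t with
  | zero => simp
  | tmul a b => simp [evalRight, mul_comm]
  | add s t hs ht => simp [← hs, ← ht]

theorem evalLeft_lTensor (h : U) (D : regular e V →ₗ[ℂ] regular e V)
    (t : regular e U ⊗[ℂ] regular e V) : evalLeft h (D.lTensor _ t) = D (evalLeft h t) := by
  induction t with
  | zero => simp
  | tmul a b => simp [evalLeft]
  | add s t hs ht => simp [hs, ht]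

theorem evalRight_rTensor (k : V) (D : regular e U →ₗ[ℂ] regular e U)
    (t : regular e U ⊗[ℂ] regular e V) : evalRight k (D.rTensor _ t) = D (evalRight k t) := by
  induction t with
  | zero => simp
  | tmul a b => simp [evalRight]
  | add s t hs ht => simp [hs, ht]

end Separation

section Product

variable {ι : Type} [Fintype ι] [DecidableEq ι] {n : ι → ℕ} {G : ι → Type*}
  [∀ p, CommGroup (G p)] {θ : ∀ p, G p → ℙ ℂ (Fin (n p + 1) → ℂ)}

/-- Near a pair of points the homogeneous coordinates of a product are separated functions. -/
theorem exists_separated_coordinates (hG : ∀ p, IsConnectedAlgebraicGroup (θ p))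
    (i j : ∀ p, Fin (n p + 1)) (g : (chartAt (piEmb θ) i).1) (x : (chartAt (piEmb θ) j).1) :
    ∃ M : Var n → regular (piEmb θ) (chartAt (piEmb θ) i).1 ⊗[ℂ]
        regular (piEmb θ) (chartAt (piEmb θ) j).1,
      (∀ p, ∃ l, evalPair g x (M ⟨p, l⟩) ≠ 0) ∧
      ∀ h k p, (∃ l, evalPair h k (M ⟨p, l⟩) ≠ 0) →
        ∃ c : ℂ, c ≠ 0 ∧ ∀ l, (piEmb θ (h.1 * k.1) p).rep l = c * evalPair h k (M ⟨p, l⟩) := by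
  have key : ∀ p, ∃ M : Fin (n p + 1) → regular (piEmb θ) (chartAt (piEmb θ) i).1 ⊗[ℂ] regular (piEmb θ) (chartAt (piEmb θ) j).1,
      (∃ l, evalPair g x (M l) ≠ 0) ∧
      ∀ h k, (∃ l, evalPair h k (M l) ≠ 0) →
        ∃ c : ℂ, c ≠ 0 ∧ ∀ l, (piEmb θ (h.1 * k.1) p).rep l = c * evalPair h k (M l) := by
    intro p
    obtain ⟨d, F, hF, h0, hmul⟩ := (hG p).mul (g.1 p, x.1 p) ()
    -- The two blocks of variables of the group law become affine coordinates on the left and on the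
    -- right tensor factor.
    let a : Var (fun _ : Bool × Unit => n p) →
        regular (piEmb θ) (chartAt (piEmb θ) i).1 ⊗[ℂ] regular (piEmb θ) (chartAt (piEmb θ) j).1 := fun v =>
      bif v.1.1 then 1 ⊗ₜ coord (piEmb θ) j ⟨p, v.2⟩ else coord (piEmb θ) i ⟨p, v.2⟩ ⊗ₜ 1
    -- The scalar `c` does not depend on `l`, because all `F l` have the same multidegree.
    have hval : ∀ (h : (chartAt (piEmb θ) i).1) (k : (chartAt (piEmb θ) j).1), ∃ c : ℂ, c ≠ 0 ∧ ∀ l,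
        value (F l) (prodEmb (single (θ p)) (h.1 p, k.1 p)) =
          c * evalPair h k (aeval a (F l)) := by
      intro h k
      refine ⟨∏ s : Bool × Unit,
        (bif s.1 then (piEmb θ k p).rep (j p) else (piEmb θ h p).rep (i p)) ^ d s, ?_, fun l => ?_⟩
      · refine Finset.prod_ne_zero_iff.mpr fun s _ => pow_ne_zero _ ?_
        rcases s with ⟨_ | _, _⟩
        · exact h.2 p
        · exact k.2 p
      · rw [comp_aeval_apply, aeval_eq_eval]
        refine value_eq_of_rep_eq (hF l) ?_
        rintro ⟨⟨_ | _, _⟩, v⟩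
        · simpa [a, prodEmb, single, piEmb] using rep_eq_mul_coord (piEmb θ) i h ⟨p, v⟩
        · simpa [a, prodEmb, single, piEmb] using rep_eq_mul_coord (piEmb θ) j k ⟨p, v⟩
    refine ⟨fun l => aeval a (F l), ?_, ?_⟩
    · obtain ⟨c, hc, h⟩ := hval g x
      obtain ⟨l, hl⟩ := Function.ne_iff.mp h0
      refine ⟨l, fun h' => hl ?_⟩
      simp only [h, h', mul_zero, Pi.zero_apply]
    · rintro h k ⟨l, hl⟩
      obtain ⟨c, hc, hv⟩ := hval h k
      have hne : (fun l => value (F l) (prodEmb (single (θ p)) (h.1 p, k.1 p))) ≠ 0 :=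
        Function.ne_iff.mpr ⟨l, by simpa only [hv, Pi.zero_apply] using mul_ne_zero hc hl⟩
      have h1 := hmul (h.1 p, k.1 p) hne
      obtain ⟨u, hu⟩ := Projectivization.exists_smul_eq_mk_rep ℂ _ hne
      refine ⟨u.1 * c, mul_ne_zero u.ne_zero hc, fun l => ?_⟩
      have h2 : piEmb θ (h.1 * k.1) p = Projectivization.mk ℂ _ hne := h1.symm
      rw [h2, ← hu, Pi.smul_apply, hv, mul_assoc]
      rfl
  choose M hM hM' using key
  exact ⟨fun v => M v.1 v.2, hM, fun h k p => hM' p h k⟩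

/-- Near a pair of points `g`, `x`, the function `(h, k) ↦ f (h * k)` is the quotient of two
separated functions. -/
theorem exists_separated (hG : ∀ p, IsConnectedAlgebraicGroup (θ p))
    (i j : ∀ p, Fin (n p + 1)) (g : (chartAt (piEmb θ) i).1) (x : (chartAt (piEmb θ) j).1)
    (U : ZOpen (piEmb θ)) (f : regular (piEmb θ) U.1) (hgx : g.1 * x.1 ∈ U.1) :
    ∃ a b : regular (piEmb θ) (chartAt (piEmb θ) i).1 ⊗[ℂ]
        regular (piEmb θ) (chartAt (piEmb θ) j).1,
      evalPair g x b ≠ 0 ∧ ∀ h k, evalPair h k b ≠ 0 → ∃ hU : h.1 * k.1 ∈ U.1,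
        evalPair h k b * f.1 ⟨h.1 * k.1, hU⟩ = evalPair h k a := by
  obtain ⟨M, hM, hM'⟩ := exists_separated_coordinates hG i j g x
  obtain ⟨d, P, hP, Q, hQ, hQ0, hf⟩ := f.2 ⟨_, hgx⟩
  obtain ⟨d', F, hF, hF0, hFU⟩ := exists_basic_of_isOpen U.2 hgx
  choose l hl using hM
  have hval : ∀ h k, (∀ p, evalPair h k (M ⟨p, l p⟩) ≠ 0) → ∃ c : ι → ℂ, (∀ p, c p ≠ 0) ∧
      ∀ {d : ι → ℕ} {P : Poly n}, P ∈ Component n d → value P (piEmb θ (h.1 * k.1)) =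
        (∏ p, c p ^ d p) * evalPair h k (aeval M P) := by
    intro h k hne
    choose c hc hc' using fun p => hM' h k p ⟨l p, hne p⟩
    refine ⟨c, hc, fun {d P} hP => ?_⟩
    rw [comp_aeval_apply, aeval_eq_eval]
    exact value_eq_of_rep_eq hP fun v => hc' v.1 v.2
  have hprod : ∀ {c : ι → ℂ}, (∀ p, c p ≠ 0) → ∀ d : ι → ℕ, ∏ p, c p ^ d p ≠ 0 := fun hc d =>
    Finset.prod_ne_zero_iff.mpr fun p _ => pow_ne_zero _ (hc p)
  -- Where the denominator is nonzero, `∏ M` makes `M` a system of coordinates of `h * k`, `F`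
  -- forces `h * k ∈ U`, and `Q` validates `f = P / Q`.
  refine ⟨aeval M (P * F) * ∏ p, M ⟨p, l p⟩, aeval M (Q * F) * ∏ p, M ⟨p, l p⟩, ?_, ?_⟩
  · rw [map_mul, map_prod, map_mul, map_mul]
    obtain ⟨c, hc, hv⟩ := hval g x hl
    simp only at hQ0
    rw [hv hQ] at hQ0
    rw [hv hF] at hF0
    exact mul_ne_zero (mul_ne_zero (right_ne_zero_of_mul hQ0) (right_ne_zero_of_mul hF0))
      (Finset.prod_ne_zero_iff.mpr fun p _ => hl p)
  · intro h k hne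
    simp only [map_mul, map_prod] at hne ⊢
    have h1 := Finset.prod_ne_zero_iff.mp (right_ne_zero_of_mul hne)
    obtain ⟨c, hc, hv⟩ := hval h k fun p => h1 p (Finset.mem_univ p)
    have h2 := right_ne_zero_of_mul (left_ne_zero_of_mul hne)
    have h3 := left_ne_zero_of_mul (left_ne_zero_of_mul hne)
    have hU : h.1 * k.1 ∈ U.1 := hFU _ (by rw [hv hF]; exact mul_ne_zero (hprod hc _) h2)
    refine ⟨hU, ?_⟩
    have h4 := hf ⟨_, hU⟩ (by simp only [hv hQ]; exact mul_ne_zero (hprod hc _) h3)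
    simp only [hv hP, hv hQ] at h4
    rw [h4, mul_div_mul_left _ _ (hprod hc _)]
    field_simp

end Product

/-! ### Invariant derivations commute and are determined by their values at a point -/

/-- If the translate of `f` by `g` is the quotient of `a` and `b` wherever `b ≠ 0`, then it is
regular there. -/
theorem exists_regular_translate {ι : Type} [DecidableEq ι] {n : ι → ℕ} {X : Type*} [CommGroup X]
    {e : X → Points n} {g : X} {U W : ZOpen e} {f : regular e U.1} {a b : regular e W.1}
    (hab : ∀ x, b.1 x ≠ 0 → ∃ hU : g * x.1 ∈ U.1, b.1 x * f.1 ⟨g * x.1, hU⟩ = a.1 x)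
    (x : W.1) (hx : b.1 x ≠ 0) :
    ∃ V : ZOpen e, x.1 ∈ V.1 ∧ (∀ y ∈ V.1, ∃ hW : y ∈ W.1, b.1 ⟨y, hW⟩ ≠ 0) ∧
      ∃ hVU : ∀ y ∈ V.1, g * y ∈ U.1, ∃ f' : regular e V.1,
        ∀ y : V.1, f'.1 y = f.1 ⟨g * y.1, hVU y.1 y.2⟩ := by
  let V : ZOpen e := ⟨{x | ∃ h : x ∈ W.1, b.1 ⟨x, h⟩ ≠ 0}, isOpen_ne_zero W b⟩
  have hVW : ∀ y ∈ V.1, y ∈ W.1 := fun y hy => hy.1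
  refine ⟨V, ⟨x.2, hx⟩, fun y hy => hy, fun y hy => (hab _ hy.2).1,
    regularDiv hVW a b fun y => y.2.2, fun y => ?_⟩
  obtain ⟨h1, h2⟩ := hab ⟨y.1, y.2.1⟩ y.2.2
  simp only [regularDiv]
  rw [← h2, mul_div_cancel_left₀ _ y.2.2]

/-- Differentiate `b * f' = a`, where `f'` is the translate of `f`, on an open set where `f'` is
regular; invariance turns `D f'` at `x` into `D f` at `g * x`. This is the quotient rule with
denominators cleared. -/
theorem invariant_leibniz {ι : Type} [DecidableEq ι] {n : ι → ℕ} {X : Type*} [CommGroup X]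
    {e : X → Points n} (D : invariantDerivations e) {g : X} {U W : ZOpen e} {f : regular e U.1}
    {a b : regular e W.1}
    (hab : ∀ x, b.1 x ≠ 0 → ∃ hU : g * x.1 ∈ U.1, b.1 x * f.1 ⟨g * x.1, hU⟩ = a.1 x)
    (x : W.1) (hx : b.1 x ≠ 0) (hU : g * x.1 ∈ U.1) :
    (D.1 W b).1 x * f.1 ⟨g * x.1, hU⟩ + b.1 x * (D.1 U f).1 ⟨g * x.1, hU⟩ = (D.1 W a).1 x := by
  obtain ⟨V, hxV, hV, hVU, f', hf'⟩ := exists_regular_translate hab x hx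
  have hVW : ∀ y ∈ V.1, y ∈ W.1 := fun y hy => (hV y hy).1
  have h1 : res hVW b * f' = res hVW a := by
    ext y
    obtain ⟨_, h⟩ := hab ⟨y.1, hVW y.1 y.2⟩ (hV y.1 y.2).2
    change b.1 _ * f'.1 y = a.1 _
    rw [hf', ← h]
  have h2 := congrArg (fun c => (D.1 V c).1 ⟨x.1, hxV⟩) h1
  simp only [Derivation.leibniz] at h2
  change b.1 _ * (D.1 V f').1 _ + f'.1 _ * (D.1 V (res hVW b)).1 _ = _ at h2
  rw [D.2.1 W V hVW b (res hVW b) (fun _ => rfl), D.2.1 W V hVW a (res hVW a) (fun _ => rfl),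
    D.2.2 g U V hVU f f' hf', hf'] at h2
  rw [← h2]
  ring

/-- Commutativity of the group lets a derivation of `f (h * k)` be computed in either variable.
Computing `D` in `h` and `D'` in `k` reduces the claim to the symmetry of mixed partial derivatives.
-/
theorem invariant_comm_of_separated {ι : Type} [DecidableEq ι] {n : ι → ℕ} {X : Type*}
    [CommGroup X] {e : X → Points n} (D D' : invariantDerivations e) {U A B : ZOpen e}
    (f : regular e U.1) (g : A.1) (x : B.1) (a b : regular e A.1 ⊗[ℂ] regular e B.1)
    (hb : evalPair g x b ≠ 0)
    (hab : ∀ (h : A.1) (k : B.1), evalPair h k b ≠ 0 → ∃ hU : h.1 * k.1 ∈ U.1,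
      evalPair h k b * f.1 ⟨h.1 * k.1, hU⟩ = evalPair h k a) (hU : g.1 * x.1 ∈ U.1) :
    (D.1 U (D'.1 U f)).1 ⟨g.1 * x.1, hU⟩ = (D'.1 U (D.1 U f)).1 ⟨g.1 * x.1, hU⟩ := by
  have swap : ∀ {z z' : X} (h : z = z') (F : regular e U.1) (hz : z ∈ U.1),
      F.1 ⟨z, hz⟩ = F.1 ⟨z', h ▸ hz⟩ := by
    rintro z _ rfl F hz
    rfl
  have left : ∀ h, ∀ k : B.1, (evalLeft h b).1 k ≠ 0 → ∃ hU : h.1 * k.1 ∈ U.1,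
      (evalLeft h b).1 k * f.1 ⟨h.1 * k.1, hU⟩ = (evalLeft h a).1 k := by
    intro h k
    simpa only [evalLeft_apply] using hab h k
  have right : ∀ k, ∀ h : A.1, (evalRight k b).1 h ≠ 0 → ∃ hU : k.1 * h.1 ∈ U.1,
      (evalRight k b).1 h * f.1 ⟨k.1 * h.1, hU⟩ = (evalRight k a).1 h := by
    intro k h
    simp only [evalRight_apply]
    intro hne
    obtain ⟨h1, h2⟩ := hab h k hne
    exact ⟨mul_comm h.1 k.1 ▸ h1, by rwa [swap (mul_comm k.1 h.1) f]⟩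
  have derivLeft : ∀ (D : invariantDerivations e) h k, evalPair h k b ≠ 0 → ∀ hU,
      evalPair h k ((D.1 B).toLinearMap.lTensor _ b) * f.1 ⟨h.1 * k.1, hU⟩ +
        evalPair h k b * (D.1 U f).1 ⟨h.1 * k.1, hU⟩ =
      evalPair h k ((D.1 B).toLinearMap.lTensor _ a) := by
    intro D h k hne hU
    have := invariant_leibniz D (left h) k (by rwa [evalLeft_apply]) hU
    simpa only [← evalLeft_apply, evalLeft_lTensor, Derivation.coeFn_coe] using this
  have derivRight : ∀ (D : invariantDerivations e) h k, evalPair h k b ≠ 0 → ∀ hU,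
      evalPair h k ((D.1 A).toLinearMap.rTensor _ b) * f.1 ⟨h.1 * k.1, hU⟩ +
        evalPair h k b * (D.1 U f).1 ⟨h.1 * k.1, hU⟩ =
      evalPair h k ((D.1 A).toLinearMap.rTensor _ a) := by
    intro D h k hne hU
    have := invariant_leibniz D (right k) h (by rwa [evalRight_apply]) (mul_comm h.1 k.1 ▸ hU)
    rw [swap (mul_comm k.1 h.1) f, swap (mul_comm k.1 h.1) (D.1 U f)] at this
    simpa only [← evalRight_apply, evalRight_rTensor, Derivation.coeFn_coe] using this
  -- differentiate first in the second variable
  have e1 := invariant_leibniz D (U := U) (f := D'.1 U f) (g := x.1) (W := A)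
    -- By the quotient rule in the second variable, `D' f` has numerator `b D'a - (D'b) a` and
    -- denominator `b ^ 2`; now `D` acts on the first variable.
    (b := evalRight x b * evalRight x b)
    (a := evalRight x b * evalRight x ((D'.1 B).toLinearMap.lTensor _ a) -
      evalRight x ((D'.1 B).toLinearMap.lTensor _ b) * evalRight x a) (by
    intro h hne
    have hne' : (evalRight x b).1 h ≠ 0 := left_ne_zero_of_mul hne
    obtain ⟨h1, h2⟩ := right x h hne'
    refine ⟨h1, ?_⟩
    have h3 := derivLeft D' h x (by rwa [← evalRight_apply]) (mul_comm x.1 h.1 ▸ h1)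
    rw [swap (mul_comm h.1 x.1) f, swap (mul_comm h.1 x.1) (D'.1 U f)] at h3
    change (evalRight x b).1 h * (evalRight x b).1 h * _ = (evalRight x b).1 h *
      (evalRight x ((D'.1 B).toLinearMap.lTensor _ a)).1 h -
        (evalRight x ((D'.1 B).toLinearMap.lTensor _ b)).1 h * (evalRight x a).1 h
    rw [← h2]
    simp only [evalRight_apply] at h2 ⊢
    rw [← h3]
    ring) g (by
      change (evalRight x b).1 g * (evalRight x b).1 g ≠ 0
      rw [evalRight_apply]
      exact mul_ne_zero hb hb) (mul_comm g.1 x.1 ▸ hU)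
  -- differentiate first in the first variable
  have e2 := invariant_leibniz D' (U := U) (f := D.1 U f) (g := g.1) (W := B)
    (b := evalLeft g b * evalLeft g b)
    (a := evalLeft g b * evalLeft g ((D.1 A).toLinearMap.rTensor _ a) -
      evalLeft g ((D.1 A).toLinearMap.rTensor _ b) * evalLeft g a) (by
    intro k hne
    have hne' : (evalLeft g b).1 k ≠ 0 := left_ne_zero_of_mul hne
    obtain ⟨h1, h2⟩ := left g k hne'
    refine ⟨h1, ?_⟩
    have h3 := derivRight D g k (by rwa [← evalLeft_apply]) h1
    change (evalLeft g b).1 k * (evalLeft g b).1 k * _ = (evalLeft g b).1 k *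
      (evalLeft g ((D.1 A).toLinearMap.rTensor _ a)).1 k -
        (evalLeft g ((D.1 A).toLinearMap.rTensor _ b)).1 k * (evalLeft g a).1 k
    rw [← h2]
    simp only [evalLeft_apply] at h2 ⊢
    rw [← h3]
    ring) x (by
      change (evalLeft g b).1 x * (evalLeft g b).1 x ≠ 0
      rw [evalLeft_apply]
      exact mul_ne_zero hb hb) hU
  have e3 := derivLeft D' g x hb hU
  have e4 := derivRight D g x hb hU
  obtain ⟨_, e5⟩ := hab g x hb
  rw [swap (mul_comm x.1 g.1) (D'.1 U f), swap (mul_comm x.1 g.1) (D.1 U (D'.1 U f))] at e1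
  have mixed : ∀ t : regular e A.1 ⊗[ℂ] regular e B.1,
      (D'.1 B).toLinearMap.lTensor _ ((D.1 A).toLinearMap.rTensor _ t) =
      (D.1 A).toLinearMap.rTensor _ ((D'.1 B).toLinearMap.lTensor _ t) := by
    intro t
    rw [← LinearMap.comp_apply, ← LinearMap.comp_apply, LinearMap.lTensor_comp_rTensor,
      LinearMap.rTensor_comp_lTensor]
  simp only [Derivation.leibniz, map_sub, smul_eq_mul] at e1 e2
  have cR : ∀ t, D.1 A (evalRight x t) = evalRight x ((D.1 A).toLinearMap.rTensor _ t) :=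
    fun t => (evalRight_rTensor x (D.1 A).toLinearMap t).symm
  have cL : ∀ t, D'.1 B (evalLeft g t) = evalLeft g ((D'.1 B).toLinearMap.lTensor _ t) :=
    fun t => (evalLeft_lTensor g (D'.1 B).toLinearMap t).symm
  simp only [cR, cL, mixed] at e1 e2
  simp only [Subalgebra.coe_add, Subalgebra.coe_sub, Subalgebra.coe_mul, Pi.add_apply,
    Pi.sub_apply, Pi.mul_apply, evalRight_apply, evalLeft_apply] at e1 e2
  -- Once `a` and its first derivatives are expressed through `f` and `b`, the two second-order
  -- identities differ only in the commutator term.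
  have hfin : evalPair g x b ^ 2 * ((D.1 U (D'.1 U f)).1 ⟨g.1 * x.1, hU⟩ -
      (D'.1 U (D.1 U f)).1 ⟨g.1 * x.1, hU⟩) = 0 := by
    rw [← e5, ← e3, ← e4] at e1 e2
    linear_combination e1 - e2
  have h0 := sub_eq_zero.mp ((mul_eq_zero.mp hfin).resolve_left (pow_ne_zero 2 hb))
  exact h0

section Product

variable {ι : Type} [Fintype ι] [DecidableEq ι] {n : ι → ℕ} {G : ι → Type*}
  [∀ p, CommGroup (G p)] {θ : ∀ p, G p → ℙ ℂ (Fin (n p + 1) → ℂ)}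

/-- Invariant derivations of a commutative algebraic group commute. -/
theorem invariant_comm (hG : ∀ p, IsConnectedAlgebraicGroup (θ p))
    (D D' : invariantDerivations (piEmb θ)) (U : ZOpen (piEmb θ)) (f : regular (piEmb θ) U.1) :
    D.1 U (D'.1 U f) = D'.1 U (D.1 U f) := by
  ext ⟨y, hy⟩
  -- The point `y` is treated as the product `1 * y`, so the separated form is taken near the pair
  -- `(1, y)`.
  obtain ⟨i, hi⟩ := exists_mem_chartAt (piEmb θ) (1 : ∀ p, G p)
  obtain ⟨j, hj⟩ := exists_mem_chartAt (piEmb θ) y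
  have h1 : 1 * y ∈ U.1 := by rwa [one_mul]
  obtain ⟨a, b, hb, hab⟩ := exists_separated hG i j ⟨1, hi⟩ ⟨y, hj⟩ U f h1
  have h := invariant_comm_of_separated D D' f _ _ a b hb hab h1
  simpa only [one_mul] using h

/-- Translates of regular functions are regular near every point. -/
theorem exists_translate (hG : ∀ p, IsConnectedAlgebraicGroup (θ p)) (U : ZOpen (piEmb θ))
    (f : regular (piEmb θ) U.1) (g x : ∀ p, G p) (hgx : g * x ∈ U.1) :
    ∃ V : ZOpen (piEmb θ), x ∈ V.1 ∧ ∃ hVU : ∀ y ∈ V.1, g * y ∈ U.1,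
      ∃ f' : regular (piEmb θ) V.1, ∀ y : V.1, f'.1 y = f.1 ⟨g * y.1, hVU y.1 y.2⟩ := by
  obtain ⟨i, hi⟩ := exists_mem_chartAt (piEmb θ) g
  obtain ⟨j, hj⟩ := exists_mem_chartAt (piEmb θ) x
  obtain ⟨a, b, hb, hab⟩ := exists_separated hG i j ⟨g, hi⟩ ⟨x, hj⟩ U f hgx
  obtain ⟨V, h1, -, h2⟩ := exists_regular_translate (f := f) (g := g)
    (a := evalLeft ⟨g, hi⟩ a) (b := evalLeft ⟨g, hi⟩ b)
    (by simpa only [evalLeft_apply] using hab ⟨g, hi⟩) ⟨x, hj⟩ (by rwa [evalLeft_apply])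
  exact ⟨V, h1, h2⟩

/-- An invariant derivation that kills the affine coordinates at one point is zero. -/
theorem invariant_eq_zero (hG : ∀ p, IsConnectedAlgebraicGroup (θ p))
    (D : invariantDerivations (piEmb θ)) (j : ∀ p, Fin (n p + 1))
    (x : (chartAt (piEmb θ) j).1)
    (hD : ∀ v, (D.1 (chartAt (piEmb θ) j) (coord (piEmb θ) j v)).1 x = 0) : D = 0 := by
  have hpoly : ∀ P : Poly n, (D.1 (chartAt (piEmb θ) j) (aeval (coord (piEmb θ) j) P)).1 x = 0 := by
    intro P
    induction P using MvPolynomial.induction_on with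
    | C c => simp
    | add P Q hP hQ => simp [hP, hQ]
    | mul_X P v hP => simp [hP, hD]
  -- Near `x` a regular function is a quotient of polynomials in the affine coordinates, so the
  -- quotient rule (translation by `1`) passes from `hpoly` to every `f`.
  have hx : ∀ (U : ZOpen (piEmb θ)) (f : regular (piEmb θ) U.1) (hxU : x.1 ∈ U.1),
      (D.1 U f).1 ⟨x.1, hxU⟩ = 0 := by
    intro U f hxU
    obtain ⟨d, P, hP, Q, hQ, hQ0, hf⟩ := f.2 ⟨_, hxU⟩
    obtain ⟨d', F, hF, hF0, hFU⟩ := exists_basic_of_isOpen U.2 hxU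
    have hval : ∀ (y : (chartAt (piEmb θ) j).1) {d : ι → ℕ}, ∃ c : ℂ, c ≠ 0 ∧
        ∀ {P : Poly n}, P ∈ Component n d →
        value P (piEmb θ y) = c * (aeval (coord (piEmb θ) j) P : regular (piEmb θ) (chartAt (piEmb θ) j).1).1 y := by
      intro y d
      refine ⟨∏ p, (piEmb θ y p).rep (j p) ^ d p,
        Finset.prod_ne_zero_iff.mpr fun p _ => pow_ne_zero _ (y.2 p), fun {P} hP => ?_⟩
      rw [aeval_regular_apply, value_eq_mul_eval_coord _ j y hP]
    have key := invariant_leibniz D (g := 1) (U := U) (f := f) (W := chartAt (piEmb θ) j)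
      (a := aeval (coord (piEmb θ) j) (P * F)) (b := aeval (coord (piEmb θ) j) (Q * F)) (by
        intro y hy
        have hy' : (aeval (coord (piEmb θ) j) Q : regular (piEmb θ) (chartAt (piEmb θ) j).1).1 y *
          (aeval (coord (piEmb θ) j) F : regular (piEmb θ) (chartAt (piEmb θ) j).1).1 y ≠ 0 := by
          rwa [map_mul] at hy
        obtain ⟨c, hc, h⟩ := hval y (d := d)
        obtain ⟨c', hc', h'⟩ := hval y (d := d')
        have hyU : y.1 ∈ U.1 := hFU _ (by
          rw [h' hF]; exact mul_ne_zero hc' (right_ne_zero_of_mul hy'))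
        have hq := left_ne_zero_of_mul hy'
        have h3 := hf ⟨y, hyU⟩ (by simp only [h hQ]; exact mul_ne_zero hc hq)
        simp only [h hP, h hQ] at h3
        rw [mul_div_mul_left _ _ hc] at h3
        refine ⟨by rwa [one_mul], ?_⟩
        simp only [one_mul, h3, map_mul, Subalgebra.coe_mul, Pi.mul_apply]
        field_simp) x (by
        obtain ⟨c, hc, h⟩ := hval x (d := d)
        obtain ⟨c', hc', h'⟩ := hval x (d := d')
        simp only at hQ0
        rw [h hQ] at hQ0
        rw [h' hF] at hF0
        simp only [map_mul, Subalgebra.coe_mul, Pi.mul_apply]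
        exact mul_ne_zero (right_ne_zero_of_mul hQ0) (right_ne_zero_of_mul hF0))
        (by rwa [one_mul])
    rw [hpoly, hpoly, zero_mul, zero_add] at key
    simp only [one_mul] at key
    refine (mul_eq_zero.mp key).resolve_left ?_
    obtain ⟨c, hc, h⟩ := hval x (d := d)
    obtain ⟨c', hc', h'⟩ := hval x (d := d')
    simp only at hQ0
    rw [h hQ] at hQ0
    rw [h' hF] at hF0
    simp only [map_mul, Subalgebra.coe_mul, Pi.mul_apply]
    exact mul_ne_zero (right_ne_zero_of_mul hQ0) (right_ne_zero_of_mul hF0)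
  refine Subtype.ext (funext fun U => Derivation.ext fun f => Subtype.ext (funext fun y => ?_))
  -- Translation by `y * x⁻¹` carries the vanishing at `x` to an arbitrary point `y`.
  have hy : (y.1 * x.1⁻¹) * x.1 = y.1 := by group
  obtain ⟨V, hxV, hVU, f', hf'⟩ := exists_translate hG U f (y.1 * x.1⁻¹) x.1 (by rw [hy]; exact y.2)
  have h1 := D.2.2 _ U V hVU f f' hf' ⟨x.1, hxV⟩
  rw [hx V f' hxV] at h1
  simp only [hy] at h1
  exact h1.symm

end Product

/-! ### Taylor expansions along commuting derivations -/

theorem prod_ofFn_pow_add_single {M : Type*} [Monoid M] {w : ℕ} (a : Fin w → M)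
    (ha : ∀ i j, Commute (a i) (a j)) (σ : Fin w → ℕ) (j : Fin w) :
    (List.ofFn fun i => a i ^ (σ i + Pi.single (M := fun _ => ℕ) j 1 i)).prod =
      (List.ofFn fun i => a i ^ σ i).prod * a j := by
  induction w with
  | zero => exact j.elim0
  | succ w ih =>
    rw [List.ofFn_succ, List.prod_cons, List.ofFn_succ, List.prod_cons]
    refine Fin.cases ?_ (fun j => ?_) j
    · have h : Commute (a 0) (List.ofFn fun i : Fin w => a i.succ ^ σ i.succ).prod := by
        refine Commute.list_prod_right _ _ fun x hx => ?_
        obtain ⟨i, rfl⟩ := List.mem_ofFn.mp hx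
        exact (ha _ _).pow_right _
      simp only [Pi.single_eq_same, pow_succ, ne_eq, Fin.succ_ne_zero, not_false_eq_true,
        Pi.single_eq_of_ne, add_zero, mul_assoc, h.eq]
    · have h := ih (fun i => a i.succ) (fun i j => ha _ _) (fun i => σ i.succ) j
      have h' : ∀ i : Fin w, Pi.single (M := fun _ => ℕ) j.succ 1 i.succ =
          Pi.single (M := fun _ => ℕ) j 1 i := fun i => by
        simp [Pi.single_apply]
      simp only [h', h, ne_eq, (Fin.succ_ne_zero _).symm, not_false_eq_true, Pi.single_eq_of_ne,
        add_zero, mul_assoc]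

section Taylor

variable {R : Type*} [CommRing R] [Algebra ℂ R] {w : ℕ}

/-- The operator `δ_1^{σ_1} ⋯ δ_w^{σ_w}`. -/
def iterDeriv (δ : Fin w → Derivation ℂ R R) (σ : Fin w → ℕ) : Module.End ℂ R :=
  (List.ofFn fun j => (δ j : R →ₗ[ℂ] R) ^ σ j).prod

theorem iterDeriv_zero (δ : Fin w → Derivation ℂ R R) : iterDeriv δ 0 = 1 := by
  simp [iterDeriv]

theorem iterDeriv_add_single {δ : Fin w → Derivation ℂ R R}
    (hδ : ∀ i j f, δ i (δ j f) = δ j (δ i f)) (σ : Fin w → ℕ) (j : Fin w) (f : R) :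
    iterDeriv δ (σ + Pi.single j 1) f = iterDeriv δ σ (δ j f) := by
  have h := prod_ofFn_pow_add_single (fun j => (δ j : Module.End ℂ R))
    (fun i j => LinearMap.ext fun f => hδ i j f) σ j
  exact LinearMap.congr_fun h f

/-- The formal Taylor expansion along the derivations `δ`. -/
def taylorSeries (δ : Fin w → Derivation ℂ R R) (f : R) : MvPowerSeries (Fin w) R :=
  fun σ => (∏ j, ((σ j).factorial : ℂ))⁻¹ • iterDeriv δ σ f

theorem coeff_taylorSeries (δ : Fin w → Derivation ℂ R R) (f : R) (σ : Fin w →₀ ℕ) :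
    MvPowerSeries.coeff σ (taylorSeries δ f) =
      (∏ j, ((σ j).factorial : ℂ))⁻¹ • iterDeriv δ σ f :=
  rfl

/-- The factor `σ i + 1` produced by formal differentiation cancels against `(σ i + 1)!`. This turns
statements about `δ i` into statements about formal partial derivatives. -/
theorem pderiv_taylorSeries {δ : Fin w → Derivation ℂ R R}
    (hδ : ∀ i j f, δ i (δ j f) = δ j (δ i f)) (i : Fin w) (f : R) :
    MvPowerSeries.pderiv R i (taylorSeries δ f) = taylorSeries δ (δ i f) := by
  ext σ
  rw [MvPowerSeries.coeff_pderiv, coeff_taylorSeries, coeff_taylorSeries, Finsupp.coe_add,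
    Finsupp.single_eq_pi_single, iterDeriv_add_single hδ]
  have h : (∏ j, (((⇑σ + Pi.single i 1 : Fin w → ℕ) j).factorial : ℂ)) =
      (σ i + 1) * ∏ j, ((σ j).factorial : ℂ) := by
    rw [← Finset.mul_prod_erase Finset.univ _ (Finset.mem_univ i),
      ← Finset.mul_prod_erase Finset.univ (fun j => ((σ j).factorial : ℂ)) (Finset.mem_univ i),
      ← mul_assoc]
    congr 1
    · simp [Nat.factorial_succ]
    · refine Finset.prod_congr rfl fun j hj => ?_
      simp [Finset.ne_of_mem_erase hj]
  have h' : ((σ i : R) + 1) = algebraMap ℂ R (σ i + 1) := by simp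
  have h0 : (σ i + 1 : ℂ) ≠ 0 := Nat.cast_add_one_ne_zero _
  rw [h, h', mul_comm, ← Algebra.smul_def, smul_smul, mul_inv, mul_inv_cancel_left₀ h0]

/-- Both sides have the same constant term, and their formal derivatives obey the same Leibniz rule.
Induction on the degree recovers each coefficient from a lower one of a derivative, as positive
integers are invertible in a `ℂ`-algebra. -/
theorem taylorSeries_mul {δ : Fin w → Derivation ℂ R R}
    (hδ : ∀ i j f, δ i (δ j f) = δ j (δ i f)) (f g : R) :
    taylorSeries δ (f * g) = taylorSeries δ f * taylorSeries δ g := by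
  have hadd : ∀ f g, taylorSeries δ (f + g) = taylorSeries δ f + taylorSeries δ g := by
    intro f g
    ext σ
    simp [coeff_taylorSeries]
  suffices h : ∀ (k : ℕ) (σ : Fin w →₀ ℕ), σ.degree = k → ∀ f g,
      MvPowerSeries.coeff σ (taylorSeries δ (f * g)) =
        MvPowerSeries.coeff σ (taylorSeries δ f * taylorSeries δ g) by
    ext σ
    exact h _ σ rfl f g
  intro k
  induction k with
  | zero =>
    intro σ hσ f g
    obtain rfl := (Finsupp.degree_eq_zero_iff σ).mp hσ
    rw [MvPowerSeries.coeff_zero_eq_constantCoeff_apply,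
      MvPowerSeries.coeff_zero_eq_constantCoeff_apply, map_mul]
    simp only [← MvPowerSeries.coeff_zero_eq_constantCoeff_apply, coeff_taylorSeries]
    simp [iterDeriv_zero]
  | succ k ih =>
    intro σ hσ f g
    obtain ⟨i, hi⟩ : ∃ i, σ i ≠ 0 := by
      by_contra! h
      rw [show σ = 0 from Finsupp.ext h] at hσ
      simp at hσ
    obtain ⟨τ, rfl⟩ : ∃ τ, σ = τ + Finsupp.single i 1 :=
      ⟨σ - Finsupp.single i 1, (tsub_add_cancel_of_le (by
        rw [Finsupp.single_le_iff]; omega)).symm⟩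
    have hτ : τ.degree = k := by simpa using hσ
    have h : ∀ F, MvPowerSeries.coeff (τ + Finsupp.single i 1) F * ((τ i : R) + 1) =
        MvPowerSeries.coeff τ (MvPowerSeries.pderiv R i F) := fun F =>
      (MvPowerSeries.coeff_pderiv F τ).symm
    have hu : IsUnit ((τ i : R) + 1) := by
      have : ((τ i : R) + 1) = algebraMap ℂ R (τ i + 1) := by simp
      rw [this]
      exact (isUnit_iff_ne_zero.mpr (Nat.cast_add_one_ne_zero _)).map _
    refine hu.mul_right_cancel ?_
    rw [h, h, Derivation.leibniz, pderiv_taylorSeries hδ, pderiv_taylorSeries hδ,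
      pderiv_taylorSeries hδ, Derivation.leibniz, hadd, map_add, map_add, smul_eq_mul, smul_eq_mul,
      smul_eq_mul, smul_eq_mul, ih τ hτ, ih τ hτ]

theorem taylorSeries_algebraMap (δ : Fin w → Derivation ℂ R R)
    (hδ : ∀ i j f, δ i (δ j f) = δ j (δ i f)) (c : ℂ) :
    taylorSeries δ (algebraMap ℂ R c) = algebraMap ℂ _ c := by
  classical
  ext σ
  rw [MvPowerSeries.algebraMap_apply, MvPowerSeries.coeff_C]
  split_ifs with h
  · subst h
    simp [coeff_taylorSeries, iterDeriv_zero]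
  · obtain ⟨i, hi⟩ : ∃ i, σ i ≠ 0 := by
      by_contra! h'
      exact h (Finsupp.ext h')
    obtain ⟨τ, rfl⟩ : ∃ τ, σ = τ + Finsupp.single i 1 :=
      ⟨σ - Finsupp.single i 1, (tsub_add_cancel_of_le (by
        rw [Finsupp.single_le_iff]; omega)).symm⟩
    rw [coeff_taylorSeries, Finsupp.coe_add, Finsupp.single_eq_pi_single,
      iterDeriv_add_single hδ]
    simp

/-- The formal Taylor expansion along commuting derivations as an algebra homomorphism. -/
def taylorHom (δ : Fin w → Derivation ℂ R R) (hδ : ∀ i j f, δ i (δ j f) = δ j (δ i f)) :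
    R →ₐ[ℂ] MvPowerSeries (Fin w) R where
  toFun := taylorSeries δ
  map_one' := by simpa using taylorSeries_algebraMap δ hδ 1
  map_mul' := taylorSeries_mul hδ
  map_zero' := by simpa using taylorSeries_algebraMap δ hδ 0
  map_add' f g := by
    ext σ
    simp [coeff_taylorSeries]
  commutes' := taylorSeries_algebraMap δ hδ

end Taylor

/-! ### Jets at a point and their ideals -/

/-- The affine coordinates `x_{p,i} / x_{p,0}` on the chart. -/
def affineCoord {ι : Type} [Fintype ι] [DecidableEq ι] {n : ι → ℕ} {X : Type*} (e : X → Points n)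
    (v : Var n) : regular e (chart e).1 :=
  coord e (fun _ => 0) v

/-- A single substitution homomorphism serves all multidegrees, which makes dehomogenization
compatible with products. -/
theorem dehomogenize_eq_aeval {ι : Type} [Fintype ι] [DecidableEq ι] {n : ι → ℕ} {X : Type*}
    {e : X → Points n} (d : ι → ℕ) (P : Component n d) :
    dehomogenize e d P = aeval (affineCoord e) P.1 := by
  ext x
  have h1 := value_eq_mul_eval_coord e (fun _ => 0) x P.2
  have h2 : value (denom n d) (e x) ≠ 0 := by
    rw [value_denom, Finset.prod_ne_zero_iff]
    exact fun p _ => pow_ne_zero _ (x.2 p)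
  rw [aeval_regular_apply]
  change value P.1 (e x) / value (denom n d) (e x) = _
  rw [div_eq_iff h2, h1, value_denom, mul_comm]
  rfl

section Jet

variable {ι : Type} [Fintype ι] [DecidableEq ι] {n : ι → ℕ} {X : Type*} [CommGroup X]
  {e : X → Points n} {w : ℕ}

/-- The derivations `D` on the affine chart commute. -/
def Commuting (D : Fin w → invariantDerivations e) : Prop :=
  ∀ i j f, (D i).1 (chart e) ((D j).1 (chart e) f) = (D j).1 (chart e) ((D i).1 (chart e) f)

/-- The Taylor expansion at a point of the chart. -/
def jet {D : Fin w → invariantDerivations e} (hD : Commuting D) (γ : (chart e).1) :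
    regular e (chart e).1 →ₐ[ℂ] MvPowerSeries (Fin w) ℂ :=
  (MvPowerSeries.mapAlgHom (evalAt e γ)).comp (taylorHom (fun j => (D j).1 (chart e)) hD)

theorem coeff_jet {D : Fin w → invariantDerivations e} (hD : Commuting D) (γ : (chart e).1)
    (σ : Fin w →₀ ℕ) (f : regular e (chart e).1) :
    MvPowerSeries.coeff σ (jet hD γ f) =
      (∏ j, ((σ j).factorial : ℂ))⁻¹ * (diffOp D σ (chart e) f).1 γ :=
  rfl

theorem coeff_jet_eq_zero_iff {D : Fin w → invariantDerivations e} (hD : Commuting D)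
    (γ : (chart e).1) (σ : Fin w →₀ ℕ) (f : regular e (chart e).1) :
    MvPowerSeries.coeff σ (jet hD γ f) = 0 ↔ (diffOp D σ (chart e) f).1 γ = 0 := by
  rw [coeff_jet, mul_eq_zero, inv_eq_zero, or_iff_right]
  exact Finset.prod_ne_zero_iff.mpr fun j _ => Nat.cast_ne_zero.mpr (Nat.factorial_ne_zero _)

/-- The Taylor expansion of a polynomial at a point, with one extra variable for each factor
recording the multidegree. -/
def gradedJet {D : Fin w → invariantDerivations e} (hD : Commuting D) (γ : (chart e).1) :
    Poly n →ₐ[ℂ] MvPowerSeries (Fin w) (MvPolynomial ι ℂ) :=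
  aeval fun v => MvPowerSeries.C (MvPolynomial.X v.1) *
    MvPowerSeries.mapAlgHom (Algebra.ofId ℂ (MvPolynomial ι ℂ)) (jet hD γ (affineCoord e v))

/-- By `aeval_rescale` the recording variables factor out as one monomial with exponent `d`, so jets
of components of different multidegrees cannot cancel. -/
theorem coeff_gradedJet_of_mem {D : Fin w → invariantDerivations e} (hD : Commuting D)
    (γ : (chart e).1) (σ : Fin w →₀ ℕ) (d : ι → ℕ) (P : Component n d) :
    MvPowerSeries.coeff σ (gradedJet hD γ P.1) =
      monomial (Finsupp.equivFunOnFinite.symm d)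
        (MvPowerSeries.coeff σ (jet hD γ (dehomogenize e d P))) := by
  have h := aeval_rescale (fun p => MvPowerSeries.C (σ := Fin w) (MvPolynomial.X p : MvPolynomial ι ℂ))
    (fun v => MvPowerSeries.mapAlgHom (Algebra.ofId ℂ (MvPolynomial ι ℂ))
      (jet hD γ (affineCoord e v))) P.2
  have h2 := comp_aeval_apply (affineCoord e)
    ((MvPowerSeries.mapAlgHom (Algebra.ofId ℂ (MvPolynomial ι ℂ))).comp (jet hD γ)) P.1
  simp only [AlgHom.comp_apply] at h2
  rw [gradedJet, h, ← h2, ← dehomogenize_eq_aeval]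
  simp only [← map_pow, ← map_prod]
  rw [MvPowerSeries.coeff_C_mul]
  change _ * C _ = _
  rw [mul_comm, monomial_eq, Finsupp.prod_fintype _ _ fun _ => pow_zero _]
  rfl

end Jet

/-! ### Linear forms separating points of the chart -/

section LinearForm

variable {ι : Type} {n : ι → ℕ}

/-- The linear form `x_v - c x_{v.1,0}`. -/
def linearForm (v : Var n) (c : ℂ) : Poly n :=
  MvPolynomial.X v - C c * MvPolynomial.X (⟨v.1, 0⟩ : Var n)

theorem linearForm_mem [DecidableEq ι] (v : Var n) (c : ℂ) : linearForm v c ∈ Component n (multideg n v) :=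
  Submodule.sub_mem _ (isWeightedHomogeneous_X ℂ _ v)
    (IsWeightedHomogeneous.C_mul (isWeightedHomogeneous_X ℂ (multideg n) (⟨v.1, 0⟩ : Var n)) c)

variable [Fintype ι] [DecidableEq ι] {X : Type*} {e : X → Points n}

theorem value_linearForm (v : Var n) (c : ℂ) (γ : (chart e).1) :
    value (linearForm v c) (e γ) =
      (e γ v.1).rep 0 * ((affineCoord e v).1 γ - c) := by
  have h := rep_eq_mul_coord e (fun _ => 0) γ v
  simp only [value, linearForm, map_sub, map_mul, eval_X, eval_C]
  rw [h, affineCoord]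
  ring

theorem eq_of_affineCoord_eq (he : Function.Injective e) {γ γ' : (chart e).1}
    (h : ∀ v, (affineCoord e v).1 γ = (affineCoord e v).1 γ') : γ = γ' := by
  refine Subtype.ext (he (funext fun p => ?_))
  rw [← Projectivization.mk_rep (e γ p), ← Projectivization.mk_rep (e γ' p),
    Projectivization.mk_eq_mk_iff']
  refine ⟨(e γ p).rep 0 / (e γ' p).rep 0, funext fun l => ?_⟩
  have h1 := rep_eq_mul_coord e (fun _ => 0) γ ⟨p, l⟩
  have h2 := rep_eq_mul_coord e (fun _ => 0) γ' ⟨p, l⟩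
  have h3 : (coord e (fun _ => 0) ⟨p, l⟩).1 γ = (coord e (fun _ => 0) ⟨p, l⟩).1 γ' := h ⟨p, l⟩
  have h4 := γ'.2 p
  simp only at h1 h2
  rw [Pi.smul_apply, h1, h2, h3, smul_eq_mul]
  field_simp

end LinearForm

/-! ### Ideals of given order at a point: homogeneity, primality, primariness -/

section JetIdeal

variable {ι : Type} [Fintype ι] [DecidableEq ι] {n : ι → ℕ} {X : Type*} [CommGroup X]
  {e : X → Points n} {w : ℕ} {D : Fin w → invariantDerivations e}

theorem coeff_coeff_gradedJet (hD : Commuting D) (γ : (chart e).1) (σ : Fin w →₀ ℕ)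
    (d : ι → ℕ) (P : Poly n) :
    coeff (Finsupp.equivFunOnFinite.symm d) (MvPowerSeries.coeff σ (gradedJet hD γ P)) =
      MvPowerSeries.coeff σ
        (jet hD γ (dehomogenize e d (DirectSum.decompose (Component n) P d))) := by
  classical
  induction P using DirectSum.Decomposition.inductionOn (Component n) with
  | zero => simp
  | @homogeneous d' P =>
    rw [coeff_gradedJet_of_mem, coeff_monomial]
    by_cases h : d' = d
    · subst h
      simp
    · rw [if_neg (fun h' => h (Finsupp.equivFunOnFinite.symm.injective h')),
        DirectSum.decompose_coe, DirectSum.of_eq_of_ne _ _ _ (Ne.symm h)]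
      simp
  | add P Q hP hQ => simp [hP, hQ]

/-- The ideal of the polynomials whose Taylor expansion at `γ` has order at least `T`. -/
def jetIdeal (hD : Commuting D) (γ : (chart e).1) (T : ℕ) : Ideal (Poly n) where
  carrier := {P | (T : ℕ∞) ≤ (gradedJet hD γ P).order}
  add_mem' {P Q} hP hQ := by
    rw [Set.mem_ofPred_eq, map_add]
    exact (le_min hP hQ).trans MvPowerSeries.min_order_le_add
  zero_mem' := by simp
  smul_mem' P Q hQ := by
    rw [Set.mem_ofPred_eq, smul_eq_mul, map_mul, MvPowerSeries.order_mul]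
    exact le_trans hQ le_add_self

theorem mem_jetIdeal {hD : Commuting D} {γ : (chart e).1} {T : ℕ} {P : Poly n} :
    P ∈ jetIdeal hD γ T ↔ (T : ℕ∞) ≤ (gradedJet hD γ P).order :=
  Iff.rfl

theorem mem_jetIdeal_iff_coeff {hD : Commuting D} {γ : (chart e).1} {T : ℕ} {P : Poly n} :
    P ∈ jetIdeal hD γ T ↔ ∀ (d : ι → ℕ) (σ : Fin w →₀ ℕ), σ.degree < T →
      MvPowerSeries.coeff σ
        (jet hD γ (dehomogenize e d (DirectSum.decompose (Component n) P d))) = 0 := by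
  rw [mem_jetIdeal]
  constructor
  · intro h d σ hσ
    rw [← coeff_coeff_gradedJet,
      MvPowerSeries.coeff_of_lt_order (lt_of_lt_of_le (by exact_mod_cast hσ) h), coeff_zero]
  · intro h
    refine MvPowerSeries.nat_le_order fun σ hσ => ?_
    ext m
    obtain ⟨d, rfl⟩ := Finsupp.equivFunOnFinite.symm.surjective m
    rw [coeff_coeff_gradedJet, h d σ hσ, coeff_zero]

theorem component_mem_jetIdeal {hD : Commuting D} {γ : (chart e).1} {T : ℕ} {d : ι → ℕ}
    {P : Component n d} :
    P.1 ∈ jetIdeal hD γ T ↔ ∀ σ : Fin w →₀ ℕ, σ.degree < T →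
      MvPowerSeries.coeff σ (jet hD γ (dehomogenize e d P)) = 0 := by
  rw [mem_jetIdeal]
  constructor
  · intro h σ hσ
    have := MvPowerSeries.coeff_of_lt_order (lt_of_lt_of_le (by exact_mod_cast hσ) h)
    rwa [coeff_gradedJet_of_mem, monomial_eq_zero] at this
  · intro h
    refine MvPowerSeries.nat_le_order fun σ hσ => ?_
    rw [coeff_gradedJet_of_mem, h σ hσ, map_zero]

theorem isHomogeneous_jetIdeal (hD : Commuting D) (γ : (chart e).1) (T : ℕ) :
    (jetIdeal hD γ T).IsHomogeneous (Component n) := by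
  intro d P hP
  rw [component_mem_jetIdeal]
  exact mem_jetIdeal_iff_coeff.mp hP d

theorem ev_eq_zero_iff (hD : Commuting D) (S : Finset (chart e).1) (T : ℕ) (d : ι → ℕ)
    (P : Component n d) : ev D S T d P = 0 ↔ ∀ γ ∈ S, P.1 ∈ jetIdeal hD γ T := by
  simp only [component_mem_jetIdeal, coeff_jet_eq_zero_iff]
  constructor
  · intro h γ hγ σ hσ
    exact congrFun h (⟨γ, hγ⟩, ⟨σ, by rwa [← Finsupp.degree_eq_sum]⟩)
  · intro h
    funext s
    have := h s.1.1 s.1.2 (Finsupp.equivFunOnFinite.symm s.2.1) (by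
      rw [Finsupp.degree_eq_sum]; exact s.2.2)
    exact this

/-- The right-hand side is homogeneous, hence generated by its homogeneous elements, and these are
exactly the elements of the kernels. -/
theorem interpolationIdeal_eq_iInf (hD : Commuting D) (S : Finset (chart e).1) (T : ℕ) :
    interpolationIdeal D S T = ⨅ γ ∈ S, jetIdeal hD γ T := by
  classical
  refine le_antisymm (Ideal.span_le.mpr ?_) fun P hP => ?_
  · rintro _ ⟨d, P, hP, rfl⟩
    simpa [Submodule.mem_iInf] using (ev_eq_zero_iff hD S T d P).mp hP
  · rw [← DirectSum.sum_support_decompose (Component n) P]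
    refine Ideal.sum_mem _ fun d _ => Ideal.subset_span ⟨d, _, ?_, rfl⟩
    rw [ev_eq_zero_iff hD]
    intro γ hγ
    simp only [Submodule.mem_iInf] at hP
    exact isHomogeneous_jetIdeal hD γ T d (hP γ hγ)

theorem interpolationIdeal_singleton (hD : Commuting D) (γ : (chart e).1) (T : ℕ) :
    interpolationIdeal D {γ} T = jetIdeal hD γ T := by
  simp [interpolationIdeal_eq_iInf hD]

theorem jetIdeal_antitone (hD : Commuting D) (γ : (chart e).1) {T T' : ℕ} (h : T ≤ T') :
    jetIdeal hD γ T' ≤ jetIdeal hD γ T := fun _ hP =>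
  le_trans (by exact_mod_cast h) (mem_jetIdeal.mp hP)

theorem notMem_jetIdeal_one {hD : Commuting D} {γ : (chart e).1} {P : Poly n} :
    P ∉ jetIdeal hD γ 1 ↔ (gradedJet hD γ P).order = 0 := by
  rw [mem_jetIdeal, Nat.cast_one, Order.one_le_iff_ne_zero, not_not]

theorem jetIdeal_ne_top (hD : Commuting D) (γ : (chart e).1) {T : ℕ} (hT : 0 < T) :
    jetIdeal hD γ T ≠ ⊤ := by
  intro h
  have h1 := jetIdeal_antitone hD γ hT ((Ideal.eq_top_iff_one _).mp h)
  refine absurd h1 (notMem_jetIdeal_one.mpr ?_)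
  rw [map_one]
  exact MvPowerSeries.weightedOrder_one _

/-- The order is additive because `MvPolynomial ι ℂ` is a domain, so products of elements of order
zero have order zero. -/
theorem isPrime_jetIdeal_one (hD : Commuting D) (γ : (chart e).1) :
    (jetIdeal hD γ 1).IsPrime := by
  refine ⟨jetIdeal_ne_top hD γ one_pos, fun {P Q} h => ?_⟩
  by_contra! h'
  rw [notMem_jetIdeal_one, notMem_jetIdeal_one] at h'
  refine notMem_jetIdeal_one.mpr ?_ h
  rw [map_mul, MvPowerSeries.order_mul, h'.1, h'.2, add_zero]

theorem radical_jetIdeal (hD : Commuting D) (γ : (chart e).1) {T : ℕ} (hT : 0 < T) :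
    (jetIdeal hD γ T).radical = jetIdeal hD γ 1 := by
  refine le_antisymm ((isPrime_jetIdeal_one hD γ).radical_le_iff.mpr
    (jetIdeal_antitone hD γ hT)) fun P hP => ⟨T, ?_⟩
  rw [mem_jetIdeal, map_pow]
  refine le_trans ?_ (MvPowerSeries.le_order_pow T)
  rw [nsmul_eq_mul]
  exact le_mul_of_one_le_right zero_le (by simpa using mem_jetIdeal.mp hP)

/-- A factor outside the radical has order zero, so by additivity it does not change the order of a
product. -/
theorem isPrimary_jetIdeal (hD : Commuting D) (γ : (chart e).1) {T : ℕ} (hT : 0 < T) :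
    (jetIdeal hD γ T).IsPrimary := by
  rw [Ideal.isPrimary_iff]
  refine ⟨jetIdeal_ne_top hD γ hT, fun {P Q} h => ?_⟩
  rw [radical_jetIdeal hD γ hT, or_iff_not_imp_right, notMem_jetIdeal_one]
  intro hQ
  rw [mem_jetIdeal, map_mul, MvPowerSeries.order_mul, hQ, add_zero] at h
  exact h

theorem component_mem_jetIdeal_one {hD : Commuting D} {γ : (chart e).1} {d : ι → ℕ}
    {P : Poly n} (hP : P ∈ Component n d) : P ∈ jetIdeal hD γ 1 ↔ value P (e γ) = 0 := by
  have h := component_mem_jetIdeal (hD := hD) (γ := γ) (T := 1) (P := ⟨P, hP⟩)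
  have h1 : (diffOp D (0 : Fin w →₀ ℕ) (chart e) (dehomogenize e d ⟨P, hP⟩)).1 γ =
      value P (e γ) / value (denom n d) (e γ) :=
    congrArg (fun L : Module.End ℂ (regular e (chart e).1) => (L (dehomogenize e d ⟨P, hP⟩)).1 γ)
      (iterDeriv_zero fun j => (D j).1 (chart e))
  have h2 : value (denom n d) (e γ) ≠ 0 := by
    rw [value_denom, Finset.prod_ne_zero_iff]
    exact fun p _ => pow_ne_zero _ (γ.2 p)
  simp only [coeff_jet_eq_zero_iff, Nat.lt_one_iff, Finsupp.degree_eq_zero_iff, forall_eq, h1,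
    div_eq_zero_iff, h2, or_false] at h
  exact h

theorem jetIdeal_one_eq_pointIdeal (hD : Commuting D) (γ : (chart e).1) :
    jetIdeal hD γ 1 = pointIdeal (e γ) := by
  rw [← interpolationIdeal_singleton, interpolationIdeal, pointIdeal]
  congr 1
  ext F
  constructor
  · rintro ⟨d, P, hP, rfl⟩
    exact ⟨d, P.2, (component_mem_jetIdeal_one P.2).mp
      ((ev_eq_zero_iff hD _ _ _ _).mp hP γ (Finset.mem_singleton_self γ))⟩
  · rintro ⟨d, hF, h⟩
    refine ⟨d, ⟨F, hF⟩, (ev_eq_zero_iff hD _ _ _ _).mpr ?_, rfl⟩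
    intro γ' hγ'
    rw [Finset.mem_singleton.mp hγ']
    exact (component_mem_jetIdeal_one hF).mpr h

theorem linearForm_mem_jetIdeal_one {hD : Commuting D} {γ : (chart e).1} {v : Var n} {c : ℂ} :
    linearForm v c ∈ jetIdeal hD γ 1 ↔ (affineCoord e v).1 γ = c := by
  rw [component_mem_jetIdeal_one (linearForm_mem v c), value_linearForm, mul_eq_zero,
    or_iff_right (γ.2 v.1), sub_eq_zero]

/-- The forms `x_v - c x_{p,0}` in the ideal of a point determine its affine coordinates, so already
an inclusion of ideals forces equality of points. -/
theorem eq_of_jetIdeal_one_le (he : Function.Injective e) {hD : Commuting D} {γ γ' : (chart e).1}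
    (h : jetIdeal hD γ 1 ≤ jetIdeal hD γ' 1) : γ = γ' :=
  eq_of_affineCoord_eq he fun _ =>
    (linearForm_mem_jetIdeal_one.mp (h (linearForm_mem_jetIdeal_one.mpr rfl))).symm

end JetIdeal

/-! ### Surjectivity of the evaluation operators -/

/-- A subspace of functions containing a triangular family is everything. -/
theorem submodule_eq_top_of_triangular {s : Type*} [Finite s] (V : Submodule ℂ (s → ℂ))
    (r : s → ℕ) (B : ℕ) (hr : ∀ i, r i < B)
    (h : ∀ i, ∃ f ∈ V, f i ≠ 0 ∧ ∀ j, j ≠ i → r j ≤ r i → f j = 0) : V = ⊤ := by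
  classical
  have := Fintype.ofFinite s
  have hsum : ∀ f : s → ℂ, f = ∑ i, f i • Pi.single (M := fun _ => ℂ) i 1 := fun f => by
    ext j
    simp [Finset.sum_apply, Pi.single_apply]
  -- Descending induction on the rank `r i`: indices of larger rank have already been handled.
  have key : ∀ k i, B ≤ r i + k → Pi.single (M := fun _ => ℂ) i 1 ∈ V := by
    intro k
    induction k with
    | zero => exact fun i hi => absurd (hr i) (by omega)
    | succ k ih =>
      intro i hi
      obtain ⟨f, hfV, hfi, hf⟩ := h i
      have h1 : f = f i • Pi.single (M := fun _ => ℂ) i 1 +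
          ∑ j ∈ Finset.univ.erase i, f j • Pi.single (M := fun _ => ℂ) j 1 := by
        rw [Finset.add_sum_erase Finset.univ
          (fun j => f j • Pi.single (M := fun _ => ℂ) j (1 : ℂ)) (Finset.mem_univ i)]
        exact hsum f
      have h2 : ∑ j ∈ Finset.univ.erase i, f j • Pi.single (M := fun _ => ℂ) j 1 ∈ V := by
        refine Submodule.sum_mem _ fun j hj => ?_
        by_cases hji : r j ≤ r i
        · rw [hf j (Finset.ne_of_mem_erase hj) hji, zero_smul]
          exact V.zero_mem
        · exact V.smul_mem _ (ih j (by omega))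
      have h3 : f i • Pi.single (M := fun _ => ℂ) i 1 ∈ V := by
        rw [eq_sub_of_add_eq h1.symm]
        exact V.sub_mem hfV h2
      exact (V.smul_mem_iff hfi).mp h3
  refine eq_top_iff.mpr fun f _ => ?_
  rw [hsum f]
  exact V.sum_mem fun i _ => V.smul_mem _ (key B i (by omega))

section Leading

variable {w : ℕ}

/-- The terms of degree at most `|σ|` of the power series `F` are the monomial `c z^σ`. -/
def HasLeading (F : MvPowerSeries (Fin w) ℂ) (σ : Fin w →₀ ℕ) (c : ℂ) : Prop :=
  ((σ.degree + 1 : ℕ) : ℕ∞) ≤ (F - MvPowerSeries.monomial σ c).order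

theorem HasLeading.coeff_eq {F : MvPowerSeries (Fin w) ℂ} {σ : Fin w →₀ ℕ} {c : ℂ}
    (h : HasLeading F σ c) (τ : Fin w →₀ ℕ) (hτ : τ.degree ≤ σ.degree) :
    MvPowerSeries.coeff τ F = if τ = σ then c else 0 := by
  classical
  have := MvPowerSeries.coeff_of_lt_order (f := F - MvPowerSeries.monomial σ c) (d := τ)
    (lt_of_lt_of_le (by exact_mod_cast Nat.lt_succ_of_le hτ) h)
  rwa [map_sub, sub_eq_zero, MvPowerSeries.coeff_monomial] at this

theorem le_order_monomial (σ : Fin w →₀ ℕ) (c : ℂ) :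
    (σ.degree : ℕ∞) ≤ (MvPowerSeries.monomial σ c).order := by
  classical
  rw [MvPowerSeries.order_monomial]
  split_ifs
  · exact le_top
  · exact le_rfl

theorem HasLeading.le_order {F : MvPowerSeries (Fin w) ℂ} {σ : Fin w →₀ ℕ} {c : ℂ}
    (h : HasLeading F σ c) : (σ.degree : ℕ∞) ≤ F.order := by
  rw [← sub_add_cancel F (MvPowerSeries.monomial σ c)]
  refine le_trans (le_min (le_trans ?_ h) (le_order_monomial σ c)) MvPowerSeries.min_order_le_add
  exact_mod_cast Nat.le_succ _

/-- With leading monomials `m`, `m'`, the error is `(F - m) F' + m (F' - m')`, and each summand has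
order above `|σ| + |σ'|`. -/
theorem HasLeading.mul {F F' : MvPowerSeries (Fin w) ℂ} {σ σ' : Fin w →₀ ℕ} {c c' : ℂ}
    (h : HasLeading F σ c) (h' : HasLeading F' σ' c') :
    HasLeading (F * F') (σ + σ') (c * c') := by
  have h1 : F * F' - MvPowerSeries.monomial (σ + σ') (c * c') =
      (F - MvPowerSeries.monomial σ c) * F' +
        MvPowerSeries.monomial σ c * (F' - MvPowerSeries.monomial σ' c') := by
    rw [← MvPowerSeries.monomial_mul_monomial]
    ring
  rw [HasLeading, h1, map_add]
  refine le_trans (le_min ?_ ?_) MvPowerSeries.min_order_le_add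
  · refine le_trans ?_ MvPowerSeries.le_order_mul
    refine le_trans (le_of_eq ?_) (add_le_add h h'.le_order)
    push_cast
    ring
  · refine le_trans ?_ MvPowerSeries.le_order_mul
    refine le_trans (le_of_eq ?_) (add_le_add (le_order_monomial σ c) h')
    push_cast
    ring

theorem hasLeading_one : HasLeading (1 : MvPowerSeries (Fin w) ℂ) 0 1 := by
  rw [HasLeading, MvPowerSeries.monomial_zero_one, sub_self, MvPowerSeries.order_zero]
  exact le_top

theorem HasLeading.pow {F : MvPowerSeries (Fin w) ℂ} {σ : Fin w →₀ ℕ}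
    (h : HasLeading F σ 1) (k : ℕ) : HasLeading (F ^ k) (k • σ) 1 := by
  induction k with
  | zero => simpa using hasLeading_one
  | succ k ih => simpa [pow_succ, succ_nsmul] using ih.mul h

theorem HasLeading.prod {κ : Type*} (s : Finset κ) {F : κ → MvPowerSeries (Fin w) ℂ}
    {σ : κ → Fin w →₀ ℕ} (h : ∀ i ∈ s, HasLeading (F i) (σ i) 1) :
    HasLeading (∏ i ∈ s, F i) (∑ i ∈ s, σ i) 1 := by
  classical
  induction s using Finset.induction_on with
  | empty => simpa using hasLeading_one
  | insert i s hi ih =>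
    rw [Finset.prod_insert hi, Finset.sum_insert hi]
    simpa using (h i (Finset.mem_insert_self i s)).mul
      (ih fun j hj => h j (Finset.mem_insert_of_mem hj))

theorem hasLeading_zero_constantCoeff (F : MvPowerSeries (Fin w) ℂ) :
    HasLeading F 0 (MvPowerSeries.constantCoeff F) := by
  refine MvPowerSeries.nat_le_order fun τ hτ => ?_
  have h : τ = 0 := (Finsupp.degree_eq_zero_iff τ).mp (by simpa using hτ)
  rw [h, map_sub, MvPowerSeries.monomial_zero_eq_C_apply, MvPowerSeries.coeff_zero_C,
    MvPowerSeries.coeff_zero_eq_constantCoeff_apply, sub_self]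

end Leading

/-! ### Functions on the chart coming from a given multidegree -/

section Dehomogenization

variable {ι : Type} [Fintype ι] [DecidableEq ι] {n : ι → ℕ} {X : Type*} {e : X → Points n}

theorem dehomogenize_mul_mem {d d' : ι → ℕ} {f f' : regular e (chart e).1}
    (h : f ∈ LinearMap.range (dehomogenize e d)) (h' : f' ∈ LinearMap.range (dehomogenize e d')) :
    f * f' ∈ LinearMap.range (dehomogenize e (d + d')) := by
  obtain ⟨P, rfl⟩ := h
  obtain ⟨P', rfl⟩ := h'
  refine ⟨⟨P.1 * P'.1, IsWeightedHomogeneous.mul P.2 P'.2⟩, ?_⟩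
  simp only [dehomogenize_eq_aeval, map_mul]

theorem one_mem_range_dehomogenize (d : ι → ℕ) :
    (1 : regular e (chart e).1) ∈ LinearMap.range (dehomogenize e d) := by
  refine ⟨⟨denom n d, denom_mem n d⟩, ?_⟩
  ext x
  refine div_self ?_
  rw [value_denom, Finset.prod_ne_zero_iff]
  exact fun p _ => pow_ne_zero _ (x.2 p)

/-- Multiplying by powers of the `x_{p,0}` raises the multidegree without changing the function. -/
theorem range_dehomogenize_mono {d d' : ι → ℕ} (h : d ≤ d') :
    LinearMap.range (dehomogenize e d) ≤ LinearMap.range (dehomogenize e d') := by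
  intro f hf
  have := dehomogenize_mul_mem hf (one_mem_range_dehomogenize (e := e) (d' - d))
  rwa [mul_one, add_tsub_cancel_of_le h] at this

theorem prod_mem_range_dehomogenize {κ : Type*} (s : Finset κ) {f : κ → regular e (chart e).1}
    {d : κ → ι → ℕ} (h : ∀ i ∈ s, f i ∈ LinearMap.range (dehomogenize e (d i))) :
    ∏ i ∈ s, f i ∈ LinearMap.range (dehomogenize e (∑ i ∈ s, d i)) := by
  classical
  induction s using Finset.induction_on with
  | empty => exact one_mem_range_dehomogenize _
  | insert i s hi ih =>
    rw [Finset.prod_insert hi, Finset.sum_insert hi]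
    exact dehomogenize_mul_mem (h i (Finset.mem_insert_self i s))
      (ih fun j hj => h j (Finset.mem_insert_of_mem hj))

theorem pow_mem_range_dehomogenize {f : regular e (chart e).1} {d : ι → ℕ}
    (h : f ∈ LinearMap.range (dehomogenize e d)) (k : ℕ) :
    f ^ k ∈ LinearMap.range (dehomogenize e (k • d)) := by
  have h' := prod_mem_range_dehomogenize (Finset.range k) fun _ _ => h
  rwa [Finset.prod_const, Finset.sum_const, Finset.card_range] at h'

theorem affineCoord_sub_mem (v : Var n) (c : ℂ) :
    affineCoord e v - algebraMap ℂ _ c ∈ LinearMap.range (dehomogenize e 1) := by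
  have h : affineCoord e v ∈ LinearMap.range (dehomogenize e (multideg n v)) :=
    ⟨⟨MvPolynomial.X v, isWeightedHomogeneous_X ℂ _ _⟩, by
      rw [dehomogenize_eq_aeval, aeval_X]⟩
  refine Submodule.sub_mem _ (range_dehomogenize_mono (fun p => ?_) h) ?_
  · rw [multideg, Pi.single_apply]
    split_ifs <;> simp
  · rw [Algebra.algebraMap_eq_smul_one]
    exact Submodule.smul_mem _ _ (one_mem_range_dehomogenize 1)

end Dehomogenization

section Surjective

variable {ι : Type} [Fintype ι] [DecidableEq ι] {n : ι → ℕ} {X : Type*} [CommGroup X]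
  {e : X → Points n} {w : ℕ} {D : Fin w → invariantDerivations e}

theorem constantCoeff_jet (hD : Commuting D) (γ : (chart e).1) (f : regular e (chart e).1) :
    MvPowerSeries.constantCoeff (jet hD γ f) = f.1 γ := by
  rw [← MvPowerSeries.coeff_zero_eq_constantCoeff_apply]
  change (∏ j : Fin w, (((0 : Fin w →₀ ℕ) j).factorial : ℂ))⁻¹ *
    (iterDeriv (fun j => (D j).1 (chart e)) 0 f).1 γ = _
  simp [iterDeriv_zero]

theorem coeff_single_jet (hD : Commuting D) (γ : (chart e).1) (f : regular e (chart e).1)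
    (i : Fin w) :
    MvPowerSeries.coeff (Finsupp.single i 1) (jet hD γ f) = ((D i).1 (chart e) f).1 γ := by
  have h1 : iterDeriv (fun j => (D j).1 (chart e)) (Finsupp.single i 1) f =
      (D i).1 (chart e) f := by
    rw [Finsupp.single_eq_pi_single, ← zero_add (Pi.single i 1), iterDeriv_add_single hD,
      iterDeriv_zero]
    rfl
  change (∏ j : Fin w, (((Finsupp.single i 1 : Fin w →₀ ℕ) j).factorial : ℂ))⁻¹ *
    (iterDeriv (fun j => (D j).1 (chart e)) (Finsupp.single i 1) f).1 γ = _
  rw [h1, Finset.prod_eq_one, inv_one, one_mul]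
  intro j _
  rw [Finsupp.single_apply]
  split_ifs <;> simp

/-- The value at a point of the derivative of a function, as a function of the derivation. -/
def deriveAt (U : ZOpen e) (f : regular e U.1) (x : U.1) : invariantDerivations e →ₗ[ℂ] ℂ where
  toFun D := (D.1 U f).1 x
  map_add' _ _ := rfl
  map_smul' _ _ := rfl

/-- Linearly independent invariant derivations have a dual system of affine functions. -/
theorem exists_dual_functions (hD : Commuting D) (hlin : LinearIndependent ℂ D)
    (γ : (chart e).1)
    (hker : ∀ D₀ : invariantDerivations e,
      (∀ v, (D₀.1 (chart e) (affineCoord e v)).1 γ = 0) → D₀ = 0) :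
    ∃ u : Fin w → regular e (chart e).1, ∀ j, u j ∈ LinearMap.range (dehomogenize e 1) ∧
      HasLeading (jet hD γ (u j)) (Finsupp.single j 1) 1 := by
  classical
  -- `A` is the matrix of derivatives of the coordinates at `γ`. A kernel vector is a combination of
  -- the `D i` killing all coordinates there, hence zero by `hker`; the rows of a left inverse then
  -- give the coefficients of the dual functions.
  let A : (Fin w → ℂ) →ₗ[ℂ] (Var n → ℂ) := LinearMap.pi fun v =>
    Fintype.linearCombination ℂ (fun i => ((D i).1 (chart e) (affineCoord e v)).1 γ)
  have hA : Function.Injective A := by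
    refine (injective_iff_map_eq_zero A).mpr fun a ha => ?_
    have h0 : ∑ i, a i • D i = 0 := by
      refine hker _ fun v => ?_
      have h := congrFun ha v
      have h' : deriveAt (chart e) (affineCoord e v) γ (∑ i, a i • D i) =
          ∑ i, a i * deriveAt (chart e) (affineCoord e v) γ (D i) := by
        rw [map_sum]
        simp only [map_smul, smul_eq_mul]
      change deriveAt (chart e) (affineCoord e v) γ (∑ i, a i • D i) = 0
      rw [h']
      simpa [A, Fintype.linearCombination_apply, deriveAt] using h
    exact funext (Fintype.linearIndependent_iffₛ.mp hlin a 0 (by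
      rw [h0]
      simp only [Pi.zero_apply, zero_smul, Finset.sum_const_zero]))
  obtain ⟨L, hL⟩ := LinearMap.exists_leftInverse_of_injective A (LinearMap.ker_eq_bot.mpr hA)
  have hdual : ∀ i j, ∑ v, L (Pi.single v 1) j * ((D i).1 (chart e) (affineCoord e v)).1 γ =
      if j = i then 1 else 0 := by
    intro i j
    have h1 := congrFun (LinearMap.congr_fun hL (Pi.single i 1)) j
    rw [LinearMap.comp_apply, LinearMap.id_apply, Pi.single_apply,
      LinearMap.pi_apply_eq_sum_univ L, Finset.sum_apply] at h1
    rw [← h1]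
    refine Finset.sum_congr rfl fun v _ => ?_
    have h2 : A (Pi.single i 1) v = ((D i).1 (chart e) (affineCoord e v)).1 γ := by
      simp [A, Fintype.linearCombination_apply, Pi.single_apply]
    have h3 : (fun k => if v = k then (1 : ℂ) else 0) = Pi.single v 1 := by
      ext k
      simp [Pi.single_apply, eq_comm]
    rw [Pi.smul_apply, h2, smul_eq_mul, mul_comm, h3]
  refine ⟨fun j => ∑ v, L (Pi.single v 1) j •
    (affineCoord e v - algebraMap ℂ _ ((affineCoord e v).1 γ)), fun j => ⟨?_, ?_⟩⟩
  · exact Submodule.sum_mem _ fun v _ => Submodule.smul_mem _ _ (affineCoord_sub_mem v _)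
  · refine MvPowerSeries.nat_le_order fun τ hτ => ?_
    rw [map_sub, MvPowerSeries.coeff_monomial, sub_eq_zero]
    rw [Finsupp.degree_single] at hτ
    obtain h | h : τ.degree = 0 ∨ τ.degree = 1 := by omega
    · rw [(Finsupp.degree_eq_zero_iff τ).mp h, MvPowerSeries.coeff_zero_eq_constantCoeff_apply,
        constantCoeff_jet, if_neg (by simp [eq_comm])]
      rw [← evalAt_apply, map_sum]
      simp
    · obtain ⟨i, rfl⟩ : τ ∈ Set.range fun i => Finsupp.single i 1 := by
        rw [Finsupp.range_single_one]
        exact h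
      have h3 : ∀ v, evalAt e γ ((D i).1 (chart e) (L (Pi.single v 1) j •
          (affineCoord e v - algebraMap ℂ _ ((affineCoord e v).1 γ)))) =
          L (Pi.single v 1) j * ((D i).1 (chart e) (affineCoord e v)).1 γ := fun v => by
        rw [Derivation.map_smul, map_sub, Derivation.map_algebraMap, sub_zero]
        rfl
      rw [coeff_single_jet, ← evalAt_apply, map_sum, map_sum, Finset.sum_congr rfl fun v _ => h3 v,
        hdual i j]
      simp only [Finsupp.single_left_inj one_ne_zero, eq_comm]

theorem ev_surjective (hD : Commuting D) (he : Function.Injective e)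
    (hlin : LinearIndependent ℂ D) (S : Finset (chart e).1)
    (hker : ∀ γ ∈ S, ∀ D₀ : invariantDerivations e,
      (∀ v, (D₀.1 (chart e) (affineCoord e v)).1 γ = 0) → D₀ = 0)
    (T : ℕ) [Finite {σ : Fin w → ℕ // ∑ j, σ j < T}] (d : ι → ℕ) (hd : ∀ p, T * S.card ≤ d p) :
    Function.Surjective (ev D S T d) := by
  classical
  rw [← LinearMap.range_eq_top]
  refine submodule_eq_top_of_triangular _ (fun s => ∑ j, s.2.1 j) T (fun s => s.2.2) ?_
  rintro ⟨⟨γ, hγ⟩, ⟨σ, hσ⟩⟩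
  obtain ⟨u, hu⟩ := exists_dual_functions hD hlin γ (hker γ hγ)
  -- At `γ' = γ` the value `0` is a dummy: the product below omits this index.
  have hsep : ∀ γ' : (chart e).1, ∃ f : regular e (chart e).1,
      f ∈ LinearMap.range (dehomogenize e 1) ∧ f.1 γ' = 0 ∧ (γ' ≠ γ → f.1 γ ≠ 0) := by
    intro γ'
    by_cases h : γ' = γ
    · exact ⟨0, Submodule.zero_mem _, rfl, fun h' => absurd h h'⟩
    · obtain ⟨v, hv⟩ : ∃ v, (affineCoord e v).1 γ ≠ (affineCoord e v).1 γ' := by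
        by_contra! h'
        exact h (eq_of_affineCoord_eq he h').symm
      refine ⟨affineCoord e v - algebraMap ℂ _ ((affineCoord e v).1 γ'),
        affineCoord_sub_mem v _, ?_, fun _ => ?_⟩
      · rw [← evalAt_apply]
        simp
      · rw [← evalAt_apply]
        simpa using sub_ne_zero.mpr hv
  choose l hl1 hl2 hl3 using hsep
  -- The first product vanishes to order `T` at the other points and is nonzero at `γ`; the second
  -- has leading term `z^σ` at `γ`. So the jets are triangular with respect to `|σ|`.
  set f := (∏ γ' ∈ S.erase γ, l γ' ^ T) * ∏ j, u j ^ σ j with hf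
  have hmem : f ∈ LinearMap.range (dehomogenize e d) := by
    refine range_dehomogenize_mono ?_ (dehomogenize_mul_mem
      (prod_mem_range_dehomogenize (S.erase γ) fun γ' _ =>
        pow_mem_range_dehomogenize (hl1 γ') T)
      (prod_mem_range_dehomogenize Finset.univ fun j _ =>
        pow_mem_range_dehomogenize (hu j).1 (σ j)))
    -- The degree used in each block is `T (|S| - 1) + |σ|`, which is at most `T |S|` because `|σ| <
    -- T`.
    intro p
    have h1 : (S.erase γ).card + 1 = S.card := Finset.card_erase_add_one hγ
    have h2 := hd p
    rw [← h1] at h2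
    simp only [Finset.sum_const, smul_eq_mul, Pi.add_apply, Pi.smul_apply, Pi.one_apply, mul_one,
      Finset.sum_apply]
    nlinarith
  obtain ⟨P, hP⟩ := hmem
  have hlead : HasLeading (jet hD γ f) (Finsupp.equivFunOnFinite.symm σ)
      (∏ γ' ∈ S.erase γ, (l γ').1 γ ^ T) := by
    have h1 := hasLeading_zero_constantCoeff (jet hD γ (∏ γ' ∈ S.erase γ, l γ' ^ T))
    have h2 := HasLeading.prod Finset.univ fun j _ => (hu j).2.pow (σ j)
    have h3 := h1.mul h2
    have h4 : ∑ j, σ j • Finsupp.single j 1 = Finsupp.equivFunOnFinite.symm σ := by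
      ext i
      simp [Finsupp.finsetSum_apply, Finsupp.single_apply]
    have h5 : (∏ γ' ∈ S.erase γ, l γ' ^ T).1 γ = ∏ γ' ∈ S.erase γ, (l γ').1 γ ^ T := by
      rw [← evalAt_apply, map_prod]
      simp
    rw [h4, zero_add, mul_one, constantCoeff_jet, h5] at h3
    simpa only [hf, map_mul, map_prod, map_pow] using h3
  refine ⟨ev D S T d P, ⟨P, rfl⟩, ?_, ?_⟩
  · change (diffOp D σ (chart e) (dehomogenize e d P)).1 γ ≠ 0
    have h1 := hlead.coeff_eq _ le_rfl
    rw [if_pos rfl] at h1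
    have h2 := (coeff_jet_eq_zero_iff hD γ (Finsupp.equivFunOnFinite.symm σ) f).not
    rw [h1] at h2
    rw [hP]
    refine h2.mp (Finset.prod_ne_zero_iff.mpr fun γ' hγ' => pow_ne_zero _ ?_)
    exact hl3 γ' (Finset.ne_of_mem_erase hγ')
  · rintro ⟨⟨γ', hγ'⟩, ⟨τ, hτ⟩⟩ hne hle
    change (diffOp D τ (chart e) (dehomogenize e d P)).1 γ' = 0
    rw [hP]
    refine (coeff_jet_eq_zero_iff hD γ' (Finsupp.equivFunOnFinite.symm τ) f).mp ?_
    by_cases h : γ' = γ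
    · subst h
      rw [hlead.coeff_eq, if_neg]
      · intro h'
        have h'' : τ = σ := Finsupp.equivFunOnFinite.symm.injective h'
        subst h''
        exact hne rfl
      · simpa [Finsupp.degree_eq_sum] using hle
    · have h0 : ((Finsupp.equivFunOnFinite.symm τ).degree : ℕ∞) < T := by
        rw [Finsupp.degree_eq_sum]
        exact Nat.cast_lt.mpr hτ
      refine MvPowerSeries.coeff_of_lt_order (lt_of_lt_of_le h0 ?_)
      have h1 : (T : ℕ∞) ≤ (jet hD γ' (l γ' ^ T)).order := by
        rw [map_pow]
        exact MvPowerSeries.le_order_pow_of_constantCoeff_eq_zero T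
          (by rw [constantCoeff_jet, hl2])
      rw [hf, ← Finset.mul_prod_erase _ _ (Finset.mem_erase.mpr ⟨h, hγ'⟩), map_mul, map_mul]
      refine le_trans ?_ MvPowerSeries.le_order_mul
      refine le_trans ?_ le_self_add
      exact le_trans (le_trans h1 le_self_add) MvPowerSeries.le_order_mul

end Surjective

/-! ### Primary decompositions without embedded components -/

section PrimaryDecomposition

variable {R : Type*} [CommRing R]

/-- An isolated primary component is determined by the ideal and by its radical. -/
theorem mem_isolated_component_iff {I : Ideal R} {t : Finset (Ideal R)}
    (ht : Submodule.IsMinimalPrimaryDecomposition I t) {J : Ideal R} (hJ : J ∈ t)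
    (hmin : ∀ J' ∈ t, J'.radical ≤ J.radical → J' = J) (x : R) :
    x ∈ J ↔ ∃ s ∉ J.radical, s * x ∈ I := by
  classical
  have hJp : J.IsPrimary := ht.primary hJ
  have hI : ∀ y, y ∈ I ↔ ∀ J' ∈ t, y ∈ J' := fun y => by
    rw [← ht.inf_eq]
    simp [Submodule.mem_finsetInf]
  constructor
  · intro hx
    -- A prime containing a finite intersection contains one of the ideals; minimality of
    -- `J.radical` excludes this, which provides an `s` in all other components but outside
    -- `J.radical`.
    have hne : ¬ (t.erase J).inf id ≤ J.radical := by
      intro h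
      obtain ⟨J', hJ', h'⟩ := (Ideal.isPrime_radical hJp).inf_le'.mp h
      have h1 := hmin J' (Finset.mem_of_mem_erase hJ')
        ((Ideal.isPrime_radical hJp).radical_le_iff.mpr h')
      exact Finset.ne_of_mem_erase hJ' h1
    obtain ⟨s, hs, hsJ⟩ := SetLike.not_le_iff_exists.mp hne
    refine ⟨s, hsJ, (hI _).mpr fun J' hJ' => ?_⟩
    by_cases h : J' = J
    · subst h
      exact J'.mul_mem_left s hx
    · refine J'.mul_mem_right x ?_
      rw [Submodule.mem_finsetInf] at hs
      exact hs J' (Finset.mem_erase.mpr ⟨h, hJ'⟩)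
  · rintro ⟨s, hs, hsx⟩
    rw [mul_comm] at hsx
    exact ((Ideal.isPrimary_iff.mp hJp).2 ((hI _).mp hsx J hJ)).resolve_right hs

/-- Finitely many primary ideals with incomparable radicals form the only minimal primary
decomposition of their intersection. -/
theorem isMinimalPrimaryDecomposition_iff {κ : Type*} (S : Finset κ) (Q : κ → Ideal R)
    (hQ : ∀ i ∈ S, (Q i).IsPrimary)
    (hinc : ∀ i ∈ S, ∀ j ∈ S, (Q i).radical ≤ (Q j).radical → i = j) (t : Finset (Ideal R)) :
    Submodule.IsMinimalPrimaryDecomposition (⨅ i ∈ S, Q i) t ↔ (t : Set (Ideal R)) = Q '' S := by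
  classical
  have h0 : Submodule.IsMinimalPrimaryDecomposition (⨅ i ∈ S, Q i) (S.image Q) := by
    refine ⟨?_, ?_, ?_, ?_⟩
    · rw [Finset.inf_image, Finset.inf_eq_iInf]
      rfl
    · intro J hJ
      obtain ⟨i, hi, rfl⟩ := Finset.mem_image.mp hJ
      exact hQ i hi
    · intro J hJ J' hJ' hne h
      obtain ⟨i, hi, rfl⟩ := Finset.mem_image.mp hJ
      obtain ⟨j, hj, rfl⟩ := Finset.mem_image.mp hJ'
      simp only [Submodule.colon_univ] at h
      exact hne (by rw [hinc i hi j hj h.le])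
    · intro J hJ h
      obtain ⟨i, hi, rfl⟩ := Finset.mem_image.mp hJ
      have hp := Ideal.isPrime_radical (hQ i hi)
      obtain ⟨J', hJ', h'⟩ := hp.inf_le'.mp (h.trans Ideal.le_radical)
      obtain ⟨j, hj, rfl⟩ := Finset.mem_image.mp (Finset.mem_of_mem_erase hJ')
      have := hinc j hj i hi (hp.radical_le_iff.mpr h')
      subst this
      exact Finset.ne_of_mem_erase hJ' rfl
  constructor
  · intro ht
    -- First uniqueness theorem: in both decompositions the radicals are the associated primes.
    have hrad : ∀ P : Ideal R, (∃ J ∈ t, J.radical = P) ↔ ∃ i ∈ S, (Q i).radical = P := by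
      have h1 := ht.image_radical_eq_associated_primes.trans
        h0.image_radical_eq_associated_primes.symm
      simp only [Submodule.colon_univ] at h1
      intro P
      have h2 := Set.ext_iff.mp h1 P
      simpa using h2
    have hdist : ∀ J ∈ t, ∀ J' ∈ t, J.radical = J'.radical → J = J' := by
      intro J hJ J' hJ' h
      by_contra hne
      refine ht.distinct hJ hJ' hne ?_
      simpa only [Submodule.colon_univ] using h
    have hmin : ∀ J ∈ t, ∀ J' ∈ t, J'.radical ≤ J.radical → J' = J := by
      intro J hJ J' hJ' h
      obtain ⟨i, hi, hi'⟩ := (hrad _).mp ⟨J, hJ, rfl⟩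
      obtain ⟨j, hj, hj'⟩ := (hrad _).mp ⟨J', hJ', rfl⟩
      refine hdist _ hJ' _ hJ ?_
      rw [← hi', ← hj'] at h
      rw [← hi', ← hj', hinc j hj i hi h]
    have hmin0 : ∀ i ∈ S, ∀ J' ∈ S.image Q, J'.radical ≤ (Q i).radical → J' = Q i := by
      intro i hi J' hJ' h
      obtain ⟨j, hj, rfl⟩ := Finset.mem_image.mp hJ'
      rw [hinc j hj i hi h]
    -- Second uniqueness theorem: an isolated component depends only on the ideal and on its
    -- radical.
    have heq : ∀ J ∈ t, ∀ i ∈ S, (Q i).radical = J.radical → Q i = J := by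
      intro J hJ i hi h
      ext x
      rw [mem_isolated_component_iff h0 (Finset.mem_image_of_mem Q hi) (hmin0 i hi),
        mem_isolated_component_iff ht hJ (hmin J hJ), h]
    ext J
    constructor
    · intro hJ
      obtain ⟨i, hi, h⟩ := (hrad _).mp ⟨J, hJ, rfl⟩
      exact ⟨i, hi, heq J hJ i hi h⟩
    · rintro ⟨i, hi, rfl⟩
      obtain ⟨J, hJ, h⟩ := (hrad _).mpr ⟨i, hi, rfl⟩
      rw [heq J hJ i hi h.symm]
      exact hJ
  · intro ht
    have : t = S.image Q := by
      apply Finset.coe_injective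
      rw [ht, Finset.coe_image]
    rw [this]
    exact h0

end PrimaryDecomposition

/-! ### The Hilbert polynomial -/

/-- Families of `w` natural numbers with sum at most `k` correspond to families of `w + 1`
natural numbers with sum `k`. -/
def sumLtEquiv (w k : ℕ) :
    {σ : Fin w → ℕ // ∑ j, σ j < k + 1} ≃ {τ : Fin (w + 1) → ℕ // ∑ j, τ j = k} where
  -- The new zeroth entry is the slack that brings the sum up to `k`.
  toFun σ := ⟨Fin.cons (k - ∑ j, σ.1 j) σ.1, by
    have := σ.2
    rw [Fin.sum_univ_succ]
    simp only [Fin.cons_zero, Fin.cons_succ]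
    omega⟩
  invFun τ := ⟨Fin.tail τ.1, by
    have := τ.2
    rw [Fin.sum_univ_succ] at this
    simp only [Fin.tail]
    omega⟩
  left_inv σ := by simp
  right_inv τ := by
    have := τ.2
    rw [Fin.sum_univ_succ] at this
    refine Subtype.ext ?_
    conv_rhs => rw [← Fin.cons_self_tail τ.1]
    simp only [Fin.tail]
    congr 1
    omega

instance finite_sum_lt (w T : ℕ) : Finite {σ : Fin w → ℕ // ∑ j, σ j < T} := by
  refine Finite.of_injective (fun σ (j : Fin w) => (⟨σ.1 j, lt_of_le_of_lt
    (Finset.single_le_sum (f := σ.1) (fun _ _ => Nat.zero_le _) (Finset.mem_univ j)) σ.2⟩ : Fin T))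
    fun σ τ h => Subtype.ext (funext fun j => ?_)
  exact congrArg Fin.val (congrFun h j)

theorem card_sum_lt (w : ℕ) {T : ℕ} (hT : 0 < T) :
    Nat.card {σ : Fin w → ℕ // ∑ j, σ j < T} = (T - 1 + w).choose w := by
  classical
  obtain ⟨k, rfl⟩ := Nat.exists_eq_add_of_le' hT
  rw [Nat.card_congr ((sumLtEquiv w k).trans (Sym.equivNatSumOfFintype _ _).symm),
    Nat.card_eq_fintype_card, Sym.card_sym_eq_choose, Fintype.card_fin, add_tsub_cancel_right,
    ← Nat.choose_symm_add]
  congr 1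
  omega

/-- A polynomial is determined by its values on a product of infinite sets, here the integers beyond
both bounds; this gives uniqueness of the Hilbert polynomial. -/
theorem hasDegree_of_eventually {ι : Type} [Finite ι] [DecidableEq ι] {n : ι → ℕ}
    {I : Ideal (Poly n)} {N : ℕ} (d₀ : ι → ℕ) (h : ∀ d, d₀ ≤ d → hilbertFunction I d = N) :
    HasDegree I N := by
  intro P
  constructor
  · rintro ⟨d₁, h₁⟩
    refine funext_set (fun p => {x : ℚ | ∃ k : ℕ, d₀ p ⊔ d₁ p ≤ k ∧ x = k}) (fun p => ?_) ?_
    · refine Set.infinite_of_injective_forall_mem (f := fun k : ℕ => ((d₀ p ⊔ d₁ p + k : ℕ) : ℚ))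
        (fun a b hab => ?_) fun k => ⟨_, Nat.le_add_right _ _, rfl⟩
      exact Nat.add_left_cancel (Nat.cast_injective hab)
    · intro x hx
      choose d hd hxd using fun p => hx p trivial
      obtain rfl : x = fun p => (d p : ℚ) := funext hxd
      rw [eval_C, ← h₁ d fun p => le_sup_right.trans (hd p), h d fun p => le_sup_left.trans (hd p)]
  · rintro rfl
    exact ⟨d₀, fun d hd => by rw [h d hd, eval_C]⟩

/-! ### The points of the zero scheme -/

section ZeroScheme

variable {ι : Type} [Fintype ι] [DecidableEq ι] {n : ι → ℕ}

/-- An ideal containing all variables of one block is irrelevant. -/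
theorem isIrrelevant_of_block {I : Ideal (Poly n)} (p : ι)
    (h : ∀ l, MvPolynomial.X (⟨p, l⟩ : Var n) ∈ I) : IsIrrelevant I := by
  refine ⟨Pi.single p 1, fun d hd F hF => ?_⟩
  -- Modulo `I` the variables of block `p` are zero, so scaling them by `0` changes nothing; yet it
  -- multiplies the class of `F` by `0 ^ d p = 0`.
  have h1 := aeval_rescale (A := Poly n ⧸ I) (fun p' => if p' = p then 0 else 1)
    (fun v => Ideal.Quotient.mkₐ ℂ I (MvPolynomial.X v)) hF
  have h2 : (fun v : Var n => (if v.1 = p then 0 else 1) *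
      Ideal.Quotient.mkₐ ℂ I (MvPolynomial.X v)) =
      fun v => Ideal.Quotient.mkₐ ℂ I (MvPolynomial.X v) := by
    funext v
    split_ifs with hv
    · obtain ⟨p', l⟩ := v
      subst hv
      rw [zero_mul, eq_comm]
      exact Ideal.Quotient.eq_zero_iff_mem.mpr (h l)
    · rw [one_mul]
  have h3 : d p ≠ 0 := by
    have h' := hd p
    rw [Pi.single_eq_same] at h'
    exact Nat.one_le_iff_ne_zero.mp h'
  rw [h2, Finset.prod_eq_zero (Finset.mem_univ p) (by simp [h3]), zero_mul,
    ← comp_aeval_apply, aeval_X_left_apply] at h1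
  exact Ideal.Quotient.eq_zero_iff_mem.mp h1

theorem schemePoint_ext {x y : SchemePoint n} (h : x.ideal = y.ideal) : x = y := by
  cases x
  cases y
  cases h
  rfl

variable {X : Type*} [CommGroup X] {e : X → Points n} {w : ℕ}
  {D : Fin w → invariantDerivations e}

theorem denom_notMem_jetIdeal_one {hD : Commuting D} (γ : (chart e).1) (d : ι → ℕ) :
    denom n d ∉ jetIdeal hD γ 1 := by
  rw [component_mem_jetIdeal_one (denom_mem n d), value_denom, Finset.prod_eq_zero_iff]
  rintro ⟨p, -, h⟩
  exact pow_ne_zero _ (γ.2 p) h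

/-- The point of the scheme given by a complex point of the chart. -/
def pointOf (hD : Commuting D) (γ : (chart e).1) : SchemePoint n where
  ideal := jetIdeal hD γ 1
  isPrime := isPrime_jetIdeal_one hD γ
  isHomogeneous := isHomogeneous_jetIdeal hD γ 1
  relevant := by
    rintro ⟨d₀, h⟩
    exact denom_notMem_jetIdeal_one γ d₀ (h d₀ le_rfl _ (denom_mem n d₀))

/-- A strictly larger homogeneous prime contains a form not vanishing at `γ`. Modulo the point ideal
this is a nonzero multiple of `denom n d`, so some `x_{p,0}` lies in the prime. The linear forms
then put all of block `p` into it, contradicting relevance. -/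
theorem eq_pointOf {hD : Commuting D} {γ : (chart e).1} {x : SchemePoint n}
    (h : jetIdeal hD γ 1 ≤ x.ideal) : x = pointOf hD γ := by
  classical
  refine schemePoint_ext (le_antisymm (fun f hf => ?_) h)
  by_contra hfγ
  obtain ⟨d, hd⟩ : ∃ d, (DirectSum.decompose (Component n) f d : Poly n) ∉ jetIdeal hD γ 1 := by
    by_contra! h'
    refine hfγ ?_
    rw [← DirectSum.sum_support_decompose (Component n) f]
    exact Ideal.sum_mem _ fun d _ => h' d
  have hfd := x.isHomogeneous d hf
  set F := DirectSum.decompose (Component n) f d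
  rw [component_mem_jetIdeal_one F.2] at hd
  have hden : value (denom n d) (e γ) ≠ 0 := fun h' =>
    denom_notMem_jetIdeal_one (hD := hD) γ d
      ((component_mem_jetIdeal_one (denom_mem n d)).mpr h')
  set c := value F.1 (e γ) / value (denom n d) (e γ) with hc
  have h1 : F.1 - c • denom n d ∈ x.ideal := by
    refine h ((component_mem_jetIdeal_one
      (Submodule.sub_mem _ F.2 (Submodule.smul_mem _ c (denom_mem n d)))).mpr ?_)
    rw [value, map_sub, smul_eval]
    change value F.1 (e γ) - c * value (denom n d) (e γ) = 0
    rw [hc]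
    field_simp
    ring
  have h2 : denom n d ∈ x.ideal := by
    have h3 := (Submodule.sub_mem_iff_right x.ideal hfd).mp h1
    have h4 := x.ideal.mul_mem_left (C c⁻¹) h3
    rwa [← smul_eq_C_mul, smul_smul, inv_mul_cancel₀ (div_ne_zero hd hden), one_smul] at h4
  have := x.isPrime
  obtain ⟨p, -, hp⟩ := Ideal.IsPrime.prod_mem_iff.mp h2
  have hp0 := x.isPrime.mem_of_pow_mem _ hp
  refine x.relevant (isIrrelevant_of_block p fun l => ?_)
  have h5 : linearForm (⟨p, l⟩ : Var n) ((affineCoord e ⟨p, l⟩).1 γ) ∈ x.ideal :=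
    h (linearForm_mem_jetIdeal_one.mpr rfl)
  exact (Submodule.sub_mem_iff_left x.ideal (x.ideal.mul_mem_left _ hp0)).mp h5

/-- A prime above the intersection lies above some `jetIdeal hD γ T`, hence above its radical, and
so is the point `γ`. The space is finite, and its points are closed since the point ideals are
incomparable; thus it is discrete and nonempty. -/
theorem topologicalKrullDim_zeroScheme (hD : Commuting D) (he : Function.Injective e)
    (S : Finset (chart e).1) (hS : S.Nonempty) {T : ℕ} (hT : 0 < T) :
    topologicalKrullDim (zeroScheme (interpolationIdeal D S T)) = 0 := by
  have hpt : ∀ x : zeroScheme (interpolationIdeal D S T), ∃ γ : S, x.1 = pointOf hD γ.1 := by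
    rintro ⟨x, hx⟩
    change interpolationIdeal D S T ≤ x.ideal at hx
    rw [interpolationIdeal_eq_iInf hD, ← Finset.inf_eq_iInf] at hx
    obtain ⟨γ, hγ, h⟩ := x.isPrime.inf_le'.mp hx
    refine ⟨⟨γ, hγ⟩, eq_pointOf ?_⟩
    rw [← radical_jetIdeal hD γ hT]
    exact x.isPrime.radical_le_iff.mpr h
  choose φ hφ using hpt
  have : Finite (zeroScheme (interpolationIdeal D S T)) :=
    Finite.of_injective φ fun x y h => Subtype.ext (by rw [hφ x, hφ y, h])
  have : T1Space (zeroScheme (interpolationIdeal D S T)) := by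
    refine ⟨fun x => ?_⟩
    have hcont : Continuous fun y : zeroScheme (interpolationIdeal D S T) =>
        (⟨y.1.ideal, y.1.isPrime⟩ : PrimeSpectrum (Poly n)) :=
      Continuous.comp (continuous_induced_dom
        (f := fun p : SchemePoint n => (⟨p.ideal, p.isPrime⟩ : PrimeSpectrum (Poly n))))
        continuous_subtype_val
    convert (PrimeSpectrum.isClosed_zeroLocus (x.1.ideal : Set (Poly n))).preimage hcont using 1
    ext y
    rw [Set.mem_singleton_iff, Set.mem_preimage, PrimeSpectrum.mem_zeroLocus]
    constructor
    · rintro rfl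
      exact subset_rfl
    · intro h
      have h' : x.1.ideal ≤ y.1.ideal := h
      rw [hφ x, hφ y] at h'
      refine Subtype.ext ?_
      rw [hφ x, hφ y, eq_of_jetIdeal_one_le he h']
  refine le_antisymm (topologicalKrullDim_zero_of_discreteTopology _) ?_
  obtain ⟨γ, hγ⟩ := hS
  have hmem : pointOf hD γ ∈ zeroScheme (interpolationIdeal D S T) := by
    change interpolationIdeal D S T ≤ jetIdeal hD γ 1
    rw [interpolationIdeal_eq_iInf hD]
    exact (iInf₂_le γ hγ).trans (jetIdeal_antitone hD γ hT)
  have : Nonempty (TopologicalSpace.IrreducibleCloseds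
      (zeroScheme (interpolationIdeal D S T))) :=
    ⟨⟨{⟨_, hmem⟩}, isIrreducible_singleton, isClosed_singleton⟩⟩
  exact Order.krullDim_nonneg

end ZeroScheme

/-! ### Homogeneous components and Hilbert function of the interpolation ideal -/

section Main

variable {ι : Type} [Fintype ι] [DecidableEq ι] {n : ι → ℕ} {X : Type*} [CommGroup X]
  {e : X → Points n} {w : ℕ} {D : Fin w → invariantDerivations e}

theorem isHomogeneous_interpolationIdeal (hD : Commuting D) (S : Finset (chart e).1) (T : ℕ) :
    (interpolationIdeal D S T).IsHomogeneous (Component n) := by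
  rw [interpolationIdeal_eq_iInf hD]
  exact Ideal.IsHomogeneous.iInf₂ fun γ _ => isHomogeneous_jetIdeal hD γ T

theorem mem_interpolationIdeal_iff (hD : Commuting D) (S : Finset (chart e).1) (T : ℕ)
    (d : ι → ℕ) (P : Component n d) :
    P.1 ∈ interpolationIdeal D S T ↔ ev D S T d P = 0 := by
  rw [ev_eq_zero_iff hD, interpolationIdeal_eq_iInf hD]
  simp only [Submodule.mem_iInf]

theorem hilbertFunction_interpolationIdeal (hD : Commuting D) (S : Finset (chart e).1) {T : ℕ}
    (hT : 0 < T) {d : ι → ℕ} (hsurj : Function.Surjective (ev D S T d)) :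
    hilbertFunction (interpolationIdeal D S T) d = S.card * (T - 1 + w).choose w := by
  have := Fintype.ofFinite {σ : Fin w → ℕ // ∑ j, σ j < T}
  have hker : ((interpolationIdeal D S T).restrictScalars ℂ).comap (Component n d).subtype =
      LinearMap.ker (ev D S T d) := by
    ext P
    exact mem_interpolationIdeal_iff hD S T d P
  rw [hilbertFunction, hker, ((ev D S T d).quotKerEquivOfSurjective hsurj).finrank_eq,
    Module.finrank_fintype_fun_eq_card, Fintype.card_prod, Fintype.card_coe,
    ← Nat.card_eq_fintype_card, card_sum_lt w hT]

end Main

end MultiProj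

end

theorem mainTheorem10 (q : ℕ) (n : Fin q → ℕ)
    (G : Fin q → Type*) [∀ p, CommGroup (G p)] (θ : ∀ p, G p → ℙ ℂ (Fin (n p + 1) → ℂ))
    (hG : ∀ p, MultiProj.IsConnectedAlgebraicGroup (θ p))
    (w : ℕ) (Δ : Fin w → MultiProj.invariantDerivations (MultiProj.piEmb θ))
    (hΔ : LinearIndependent ℂ Δ)
    (S : Finset (MultiProj.chart (MultiProj.piEmb θ)).1) (hS : S.Nonempty)
    (T : ℕ) (hT : 0 < T) :
    -- the interpolation ideal is multihomogeneous with components the kernels of evaluation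
    ((MultiProj.interpolationIdeal Δ S T).IsHomogeneous (MultiProj.Component n) ∧
      ∀ (d : Fin q → ℕ) (P : MultiProj.Component n d),
        P.1 ∈ MultiProj.interpolationIdeal Δ S T ↔ MultiProj.ev Δ S T d P = 0) ∧
    -- evaluation is surjective in large multidegree
    (∀ d : Fin q → ℕ, (∀ p, T * S.card ≤ d p) →
      Function.Surjective (MultiProj.ev Δ S T d)) ∧
    -- the subscheme is zero-dimensional, of the stated degree
    topologicalKrullDim (MultiProj.zeroScheme (MultiProj.interpolationIdeal Δ S T)) = 0 ∧
    MultiProj.HasDegree (MultiProj.interpolationIdeal Δ S T)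
      (S.card * (T - 1 + w).choose w) ∧
    -- the components are primary to the prime ideals of the points
    (∀ γ ∈ S,
      MultiProj.interpolationIdeal Δ {γ} 1 = MultiProj.pointIdeal (MultiProj.piEmb θ γ.1) ∧
      (MultiProj.interpolationIdeal Δ {γ} 1).IsPrime ∧
      (MultiProj.interpolationIdeal Δ {γ} T).IsPrimary ∧
      (MultiProj.interpolationIdeal Δ {γ} T).radical = MultiProj.interpolationIdeal Δ {γ} 1) ∧
    -- the minimal primary decomposition
    MultiProj.interpolationIdeal Δ S T = ⨅ γ ∈ S, MultiProj.interpolationIdeal Δ {γ} T ∧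
    Set.InjOn (fun γ => MultiProj.interpolationIdeal Δ {γ} T) S ∧
    ∀ t : Finset (Ideal (MultiProj.Poly n)),
      Submodule.IsMinimalPrimaryDecomposition (MultiProj.interpolationIdeal Δ S T) t ↔
        (t : Set (Ideal (MultiProj.Poly n))) =
          (fun γ => MultiProj.interpolationIdeal Δ {γ} T) '' S := by
  have hD : MultiProj.Commuting Δ := fun i j f =>
    MultiProj.invariant_comm hG (Δ i) (Δ j) (MultiProj.chart (MultiProj.piEmb θ)) f
  have he : Function.Injective (MultiProj.piEmb θ) := fun g g' h =>
    funext fun p => (hG p).injective (congrFun h p)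
  have hsurj : ∀ d : Fin q → ℕ, (∀ p, T * S.card ≤ d p) →
      Function.Surjective (MultiProj.ev Δ S T d) :=
    MultiProj.ev_surjective hD he hΔ S
      (fun γ _ D h => MultiProj.invariant_eq_zero hG D (fun _ => 0) γ h) T
  have hone : ∀ γ, MultiProj.interpolationIdeal Δ {γ} 1 = MultiProj.jetIdeal hD γ 1 := fun γ =>
    MultiProj.interpolationIdeal_singleton hD γ 1
  have hsingle : ∀ γ, MultiProj.interpolationIdeal Δ {γ} T = MultiProj.jetIdeal hD γ T := fun γ =>
    MultiProj.interpolationIdeal_singleton hD γ T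
  -- Incomparability of the radicals yields both the distinctness of the components and the
  -- uniqueness of the decomposition.
  have hinc : ∀ γ ∈ S, ∀ γ' ∈ S, (MultiProj.jetIdeal hD γ T).radical ≤
      (MultiProj.jetIdeal hD γ' T).radical → γ = γ' := by
    intro γ _ γ' _ h
    rw [MultiProj.radical_jetIdeal hD γ hT, MultiProj.radical_jetIdeal hD γ' hT] at h
    exact MultiProj.eq_of_jetIdeal_one_le he h
  simp only [hone, hsingle]
  refine ⟨⟨MultiProj.isHomogeneous_interpolationIdeal hD S T,
    MultiProj.mem_interpolationIdeal_iff hD S T⟩, hsurj,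
    MultiProj.topologicalKrullDim_zeroScheme hD he S hS hT,
    MultiProj.hasDegree_of_eventually (fun _ => T * S.card) fun d hd =>
      MultiProj.hilbertFunction_interpolationIdeal hD S hT (hsurj d hd),
    fun γ _ => ⟨MultiProj.jetIdeal_one_eq_pointIdeal hD γ, MultiProj.isPrime_jetIdeal_one hD γ,
      MultiProj.isPrimary_jetIdeal hD γ hT, MultiProj.radical_jetIdeal hD γ hT⟩,
    MultiProj.interpolationIdeal_eq_iInf hD S T, fun γ hγ γ' hγ' h => ?_, fun t => ?_⟩
  · exact hinc γ hγ γ' hγ' (le_of_eq (congrArg Ideal.radical h))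
  · rw [MultiProj.interpolationIdeal_eq_iInf hD S T]
    exact MultiProj.isMinimalPrimaryDecomposition_iff S _
      (fun γ _ => MultiProj.isPrimary_jetIdeal hD γ hT) hinc t
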